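/- Let $M$ be a Polish space with its Borel $\sigma$-algebra and $\lambda$ a $\sigma$-finite Borel measure on $M$. Let $\mathbb M$ be the set of finite Borel measures on $M$, $\mathbb M^{ac}=\{\mu\in\mathbb M:\mu\ll\lambda\}$ and $\mathscr P^{ac}=\{\mu\in\mathbb M^{ac}:\mu(M)=1\}$, both with the total variation distance $\rho_{var}(\mu,\nu)=\int_M\big|\frac{d\mu}{d\lambda}-\frac{d\nu}{d\lambda}\big|\,d\lambda$ and its Borel $\sigma$-algebra. Let $\Lambda$ be a Borel probability measure on $\mathbb M^{ac}$. *Dirichlet forms.* For a metric space $E$ with a Borel probability measure $\Lambda$, a (symmetric) Dirichlet form $(\mathcal E,D(\mathcal E))$ on $L^2(E,\Lambda)$ is a symmetric, nonnegative bilinear form on a dense subspace $D(\mathcal E)$ that is complete for the norm $\mathcal E_1(u,u)^{1/2}$, $\mathcal E_1(u,u)=\mathcal E(u,u)+\Lambda(u^2)$, and such that $w=u^+\wedge1\in D(\mathcal E)$ and $\mathcal E(u+w,u-w)\ge0$ for all $u\in D(\mathcal E)$. Put $\mathcal E(u,u)=\infty$ if $u\notin D(\mathcal E)$. For open $O\subseteq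 E$ let $\mathrm{Cap}_1(O)=\inf\{\mathcal E_1(u,u):u\in D(\mathcal E),\ u\ge1\ \Lambda\text{-a.e. on }O\}$, with $\inf\emptyset=\infty$, and for any $A\subseteq E$ let $\mathrm{Cap}_1(A)=\inf\{\mathrm{Cap}_1(O):O\supseteq A\text{ open}\}$. A nest is a sequence of closed sets $K_n$ with $\mathrm{Cap}_1(E\setminus K_n)\to0$. A measurable $f:E\to\mathbb R$ is quasi-continuous if there is a nest $(K_n)$ with every $f|_{K_n}$ continuous. The form is quasi-regular if - (Q1) there is a nest of compact sets; - (Q2) $(D(\mathcal E),\mathcal E_1^{1/2})$ has a dense linear subspace whose elements are represented by quasi-continuous functions; - (Q3) there are $N\subseteq E$ with $\mathrm{Cap}_1(N)=0$ and a sequence of quasi-continuous functions representing elements of $D(\mathcal E)$ that separates the points of $E\setminus N$. *Derivatives.* Let $\mathscr X$ be the set of functions $u(\mu)=g(\mu(f_1),\dots,\mu(f_n))$ on $\mathbb M$ with $n\in\mathbb N$, $f_i\in C_b(M)$, $g\in C_b^1(\mathbb R^n)$. For $u\in\mathscr X$ and $x\in M$ put $D^Eu(\mu)(x)=\lim_{\varepsilon\downarrow0}\frac{u(\mu+\varepsilon\delta_x)-u(\mu)}{\varepsilon}$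 and $\tilde D^Eu(\mu)(x)=\lim_{\varepsilon\downarrow0}\frac{u((1-\varepsilon)\mu+\varepsilon\delta_x)-u(\mu)}{\varepsilon}$; also $\|u\|_\infty=\sup_{\mu\in\mathbb M}|u(\mu)|$ and $\|f\|_{L^1(\mu)+L^\infty(\mu)}:=\|f\|_{L^1(\mu)}+\|f\|_{L^\infty(\mu)}$. **Theorem.** Let $(\mathcal E,D(\mathcal E))$ be a Dirichlet form on $L^2(\mathbb M^{ac},\Lambda)$ such that $(D(\mathcal E),\mathcal E_1^{1/2})$ has a dense linear subspace whose elements are represented by quasi-continuous functions. 1. If there is $C\in(0,\infty)$ with $$\mathcal E(u,u)\le C\Big(\sup_{\mu\in\mathbb M^{ac}}\|D^Eu(\mu)\|^2_{L^1(\mu)+L^\infty(\mu)}+\|u\|_\infty^2\Big),\qquad u\in\mathscr X$$ (no condition is imposed on those $u$ for which the right-hand side is infinite), then $(\mathcal E,D(\mathcal E))$ is quasi-regular. 2. If $\Lambda(\mathscr P^{ac})=1$ and there is $C\in(0,\infty)$ with $$\mathcal E(u,u)\le C\Big(\sup_{\mu\in\mathscr P^{ac}}\|\tilde D^Eu(\mu)\|^2_{L^\infty(\mu)}+\|u\|_\infty^2\Big),\qquad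 u\in\mathscr X,$$ then $(\mathcal E,D(\mathcal E))$ is quasi-regular. Moreover, under the identification $L^2(\mathbb M^{ac},\Lambda)=L^2(\mathscr P^{ac},\Lambda)$ given by restriction of functions to $\mathscr P^{ac}$, it is also a quasi-regular Dirichlet form on $L^2(\mathscr P^{ac},\Lambda)$. -/

import Mathlib

open MeasureTheory Filter Set
open scoped ENNReal NNReal Topology BoundedContinuousFunction

noncomputable section

/-! ### Bilinear forms on `L²`, Dirichlet forms, capacity, quasi-regularity -/

/-- A bilinear form on a linear subspace (its domain) of the real space `L²(E, Λ)`. -/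
structure L2Form {E : Type*} [MeasurableSpace E] (Λ : Measure E) where
  domain : Submodule ℝ (Lp ℝ 2 Λ)
  form : LinearMap.BilinForm ℝ domain

namespace L2Form

variable {E : Type*} [MeasurableSpace E] {Λ : Measure E}

/-- `𝓔₁(u, u) = 𝓔(u, u) + Λ(u²)`. -/
def energyOne (𝓔 : L2Form Λ) (u : 𝓔.domain) : ℝ :=
  𝓔.form u u + ‖(u : Lp ℝ 2 Λ)‖ ^ 2

/-- Symmetric Dirichlet forms: densely defined, symmetric, nonnegative, closed (the domain is
complete for the `𝓔₁`-norm), and Markovian (`w = u⁺ ∧ 1` belongs to the domain and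
`𝓔(u + w, u - w) ≥ 0`). -/
structure IsDirichletForm (𝓔 : L2Form Λ) : Prop where
  dense : Dense (𝓔.domain : Set (Lp ℝ 2 Λ))
  symm : ∀ u v : 𝓔.domain, 𝓔.form u v = 𝓔.form v u
  nonneg : ∀ u : 𝓔.domain, 0 ≤ 𝓔.form u u
  complete : ∀ u : ℕ → 𝓔.domain,
    (∀ ε : ℝ, 0 < ε → ∃ N : ℕ, ∀ m ≥ N, ∀ n ≥ N, 𝓔.energyOne (u m - u n) < ε) →
    ∃ v : 𝓔.domain, Tendsto (fun n => 𝓔.energyOne (u n - v)) atTop (𝓝 0)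
  markov : ∀ u : 𝓔.domain, ∃ w : 𝓔.domain,
    ((w : Lp ℝ 2 Λ) =ᵐ[Λ] fun z => min (max ((u : Lp ℝ 2 Λ) z) 0) 1) ∧
      0 ≤ 𝓔.form (u + w) (u - w)

/-- `𝓔(f, f)` for a function `f`, with the convention that it is `∞` when `f` does not represent
an element of the domain (the infimum is over at most one element). -/
def energy (𝓔 : L2Form Λ) (f : E → ℝ) : ℝ≥0∞ :=
  ⨅ (u : 𝓔.domain) (_ : (u : Lp ℝ 2 Λ) =ᵐ[Λ] f), ENNReal.ofReal (𝓔.form u u)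

/-- The infimum of `𝓔₁(u, u)` over `u` in the domain with `u ≥ 1` a.e. on `O`, for open `O`. -/
def capOpen (𝓔 : L2Form Λ) (O : Set E) : ℝ≥0∞ :=
  ⨅ (u : 𝓔.domain) (_ : ∀ᵐ z ∂Λ, z ∈ O → 1 ≤ (u : Lp ℝ 2 Λ) z),
    ENNReal.ofReal (𝓔.energyOne u)

variable [TopologicalSpace E]

/-- The `1`-capacity of an arbitrary set. -/
def cap (𝓔 : L2Form Λ) (A : Set E) : ℝ≥0∞ :=
  ⨅ (O : Set E) (_ : IsOpen O) (_ : A ⊆ O), 𝓔.capOpen O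

/-- A nest: closed sets whose complements have capacity tending to zero. -/
def IsNest (𝓔 : L2Form Λ) (K : ℕ → Set E) : Prop :=
  (∀ n, IsClosed (K n)) ∧ Tendsto (fun n => 𝓔.cap (K n)ᶜ) atTop (𝓝 0)

/-- Quasi-continuous functions. -/
def QuasiContinuous (𝓔 : L2Form Λ) (f : E → ℝ) : Prop :=
  Measurable f ∧ ∃ K : ℕ → Set E, 𝓔.IsNest K ∧ ∀ n, ContinuousOn f (K n)

/-- The domain, with the `𝓔₁`-norm, has a dense linear subspace consisting of (classes of)
quasi-continuous functions. -/
def HasDenseQuasiContinuous (𝓔 : L2Form Λ) : Prop :=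
  ∃ S : Submodule ℝ 𝓔.domain,
    (∀ u ∈ S, ∃ f : E → ℝ, 𝓔.QuasiContinuous f ∧ ((u : Lp ℝ 2 Λ) =ᵐ[Λ] f)) ∧
    ∀ u : 𝓔.domain, ∀ ε : ℝ, 0 < ε → ∃ v ∈ S, 𝓔.energyOne (u - v) < ε

/-- Quasi-regularity. -/
structure IsQuasiRegular (𝓔 : L2Form Λ) : Prop where
  compact_nest : ∃ K : ℕ → Set E, 𝓔.IsNest K ∧ ∀ n, IsCompact (K n)
  dense_quasiContinuous : 𝓔.HasDenseQuasiContinuous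
  separating : ∃ (N : Set E) (f : ℕ → E → ℝ), 𝓔.cap N = 0 ∧
    (∀ n, 𝓔.QuasiContinuous (f n) ∧ ∃ u : 𝓔.domain, (u : Lp ℝ 2 Λ) =ᵐ[Λ] f n) ∧
    ∀ z₁ ∉ N, ∀ z₂ ∉ N, z₁ ≠ z₂ → ∃ n, f n z₁ ≠ f n z₂

end L2Form

/-! ### Restriction of a form to a set of full measure -/

lemma measurePreserving_subtypeVal_of_ae_mem {E : Type*} [MeasurableSpace E] {Λ : Measure E}
    {s : Set E} (hs : MeasurableSet s) (h : ∀ᵐ z ∂Λ, z ∈ s) :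
    MeasurePreserving (Subtype.val : s → E) (Λ.comap Subtype.val) Λ :=
  ⟨measurable_subtype_coe, by
    rw [map_comap_subtype_coe hs, Measure.restrict_eq_self_of_ae_mem h]⟩

/-- If `s` carries `Λ`, a form on `L²(E, Λ)` viewed as a form on `L²(s, Λ)`: its domain consists
of the restrictions `u|ₛ` of the elements `u` of the domain, and the value at `(u|ₛ, v|ₛ)` is
`𝓔(u, v)`. Here `s` has the induced `σ`-algebra and `Λ` is restricted to it. -/
def L2Form.restrict {E : Type*} [MeasurableSpace E] {Λ : Measure E} (𝓔 : L2Form Λ)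
    {s : Set E} (hs : MeasurableSet s) (h : ∀ᵐ z ∂Λ, z ∈ s) :
    L2Form (Λ.comap (Subtype.val : s → E)) :=
  let R : Lp ℝ 2 Λ →ₗᵢ[ℝ] Lp ℝ 2 (Λ.comap (Subtype.val : s → E)) :=
    Lp.compMeasurePreservingₗᵢ ℝ Subtype.val (measurePreserving_subtypeVal_of_ae_mem hs h)
  let e := Submodule.equivMapOfInjective R.toLinearMap R.injective 𝓔.domain
  { domain := 𝓔.domain.map R.toLinearMap
    form := 𝓔.form.compl₁₂ e.symm.toLinearMap e.symm.toLinearMap }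

/-! ### Absolutely continuous measures with the total variation distance -/

/-- Finite measures on `M` that are absolutely continuous with respect to `lam`. -/
@[ext]
structure AcMeasure {M : Type*} [MeasurableSpace M] (lam : Measure M) where
  toFiniteMeasure : FiniteMeasure M
  ac : (toFiniteMeasure : Measure M) ≪ lam

namespace AcMeasure

variable {M : Type*} [MeasurableSpace M] {lam : Measure M}

/-- The density `dμ/dlam`. -/
def density (μ : AcMeasure lam) (x : M) : ℝ :=
  ((μ.toFiniteMeasure : Measure M).rnDeriv lam x).toReal

lemma integrable_density (μ : AcMeasure lam) : Integrable μ.density lam :=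
  Measure.integrable_toReal_rnDeriv

lemma integrable_abs_sub (μ ν : AcMeasure lam) :
    Integrable (fun x => |μ.density x - ν.density x|) lam :=
  (μ.integrable_density.sub ν.integrable_density).abs

lemma eq_of_density_ae_eq [SigmaFinite lam] {μ ν : AcMeasure lam}
    (h : μ.density =ᵐ[lam] ν.density) : μ = ν := by
  have key : (μ.toFiniteMeasure : Measure M) = (ν.toFiniteMeasure : Measure M) := by
    rw [← Measure.withDensity_rnDeriv_eq _ _ μ.ac, ← Measure.withDensity_rnDeriv_eq _ _ ν.ac]
    refine withDensity_congr_ae ?_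
    filter_upwards [h, Measure.rnDeriv_lt_top (μ.toFiniteMeasure : Measure M) lam,
      Measure.rnDeriv_lt_top (ν.toFiniteMeasure : Measure M) lam] with x hx h1 h2
    exact (ENNReal.toReal_eq_toReal_iff' h1.ne h2.ne).1 hx
  ext1
  exact Subtype.ext key

/-- The total variation distance, `|μ - ν|(M) = ∫ |dμ/dlam - dν/dlam| dlam`. -/
instance [SigmaFinite lam] : MetricSpace (AcMeasure lam) where
  dist μ ν := ∫ x, |μ.density x - ν.density x| ∂lam
  dist_self μ := by simp
  dist_comm μ ν := by simp only [abs_sub_comm]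
  dist_triangle μ ν κ := by
    rw [← integral_add (integrable_abs_sub μ ν) (integrable_abs_sub ν κ)]
    exact integral_mono (integrable_abs_sub μ κ)
      ((integrable_abs_sub μ ν).add (integrable_abs_sub ν κ)) fun x => abs_sub_le _ _ _
  eq_of_dist_eq_zero := by
    intro μ ν h
    apply eq_of_density_ae_eq
    have h' := (integral_eq_zero_iff_of_nonneg (fun x => abs_nonneg _)
      (integrable_abs_sub μ ν)).1 h
    filter_upwards [h'] with x hx
    exact sub_eq_zero.1 (abs_eq_zero.1 hx)

lemma dist_def [SigmaFinite lam] (μ ν : AcMeasure lam) :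
    dist μ ν = ∫ x, |μ.density x - ν.density x| ∂lam := rfl

instance [SigmaFinite lam] : MeasurableSpace (AcMeasure lam) := borel _

instance [SigmaFinite lam] : BorelSpace (AcMeasure lam) := ⟨rfl⟩

end AcMeasure

/-- The absolutely continuous probability measures, as a subset of the absolutely continuous
finite measures. -/
def probAc {M : Type*} [MeasurableSpace M] (lam : Measure M) : Set (AcMeasure lam) :=
  {μ | (μ.toFiniteMeasure : Measure M) Set.univ = 1}

lemma integral_density_eq {M : Type*} [MeasurableSpace M] {lam : Measure M} [SigmaFinite lam]
    (μ : AcMeasure lam) :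
    ∫ x, μ.density x ∂lam = (μ.toFiniteMeasure : Measure M).real Set.univ :=
  Measure.integral_toReal_rnDeriv μ.ac

lemma isClosed_probAc {M : Type*} [MeasurableSpace M] (lam : Measure M) [SigmaFinite lam] :
    IsClosed (probAc lam) := by
  have hc : Continuous fun μ : AcMeasure lam => ∫ x, μ.density x ∂lam := by
    refine (LipschitzWith.of_dist_le_mul (K := 1) fun μ ν => ?_).continuous
    rw [Real.dist_eq, ← integral_sub μ.integrable_density ν.integrable_density, NNReal.coe_one,
      one_mul, AcMeasure.dist_def]
    exact abs_integral_le_integral_abs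
  have : probAc lam = (fun μ : AcMeasure lam => ∫ x, μ.density x ∂lam) ⁻¹' {1} := by
    ext μ
    simp only [probAc, mem_ofPred_eq, mem_preimage, mem_singleton_iff, integral_density_eq,
      Measure.real]
    rw [ENNReal.toReal_eq_one_iff]
  rw [this]
  exact isClosed_singleton.preimage hc

/-- The form on `L²` of the finite absolutely continuous measures, viewed as a form on `L²` of the
absolutely continuous probability measures, when these carry `Λ`. -/
def L2Form.toProbAc {M : Type*} [MeasurableSpace M] {lam : Measure M} [SigmaFinite lam]
    {Λ : Measure (AcMeasure lam)} [IsProbabilityMeasure Λ] (𝓔 : L2Form Λ)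
    (h : Λ (probAc lam) = 1) :
    L2Form (Λ.comap (Subtype.val : probAc lam → AcMeasure lam)) :=
  𝓔.restrict (isClosed_probAc lam).measurableSet
    ((mem_ae_iff_prob_eq_one (isClosed_probAc lam).measurableSet).2 h)

/-! ### Cylinder functions and extrinsic derivatives -/

/-- Cylinder functions `μ ↦ g(μ(f₁), …, μ(fₙ))` on the space of finite measures, with
`fᵢ ∈ C_b(M)` and `g ∈ C_b¹(ℝⁿ)`, that is, `g` is `C¹` and bounded with bounded derivative. -/
def IsCylinder {M : Type*} [TopologicalSpace M] [MeasurableSpace M]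
    (u : FiniteMeasure M → ℝ) : Prop :=
  ∃ (n : ℕ) (f : Fin n → (M →ᵇ ℝ)) (g : (Fin n → ℝ) → ℝ),
    ContDiff ℝ 1 g ∧ (∃ B : ℝ, ∀ y, |g y| ≤ B ∧ ‖fderiv ℝ g y‖ ≤ B) ∧
    ∀ μ : FiniteMeasure M, u μ = g fun i => ∫ x, f i x ∂(μ : Measure M)

/-- The Dirac measure as a finite measure. -/
def diracFin {M : Type*} [MeasurableSpace M] (x : M) : FiniteMeasure M :=
  ⟨Measure.dirac x, inferInstance⟩

/-- The extrinsic derivative `lim_{ε ↓ 0} (u(μ + ε δₓ) - u(μ)) / ε`. -/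
def extrinsicDeriv {M : Type*} [MeasurableSpace M] (u : FiniteMeasure M → ℝ) (μ : FiniteMeasure M)
    (x : M) : ℝ :=
  derivWithin (fun ε : ℝ => u (μ + ε.toNNReal • diracFin x)) (Ici 0) 0

/-- The convexity extrinsic derivative `lim_{ε ↓ 0} (u((1 - ε) μ + ε δₓ) - u(μ)) / ε`. -/
def convExtrinsicDeriv {M : Type*} [MeasurableSpace M] (u : FiniteMeasure M → ℝ)
    (μ : FiniteMeasure M) (x : M) : ℝ :=
  derivWithin (fun ε : ℝ => u ((1 - ε).toNNReal • μ + ε.toNNReal • diracFin x)) (Ici 0) 0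

/-- `‖u‖_∞`, the supremum over all finite measures. -/
def supNorm {M : Type*} [MeasurableSpace M] (u : FiniteMeasure M → ℝ) : ℝ≥0∞ :=
  ⨆ μ : FiniteMeasure M, ‖u μ‖ₑ

/-- `‖f‖_{L¹(μ)} + ‖f‖_{L^∞(μ)}`. -/
def normL1PlusLinf {M : Type*} [MeasurableSpace M] (f : M → ℝ) (μ : Measure M) : ℝ≥0∞ :=
  eLpNorm f 1 μ + eLpNorm f ∞ μ

/-- `𝓔(u, u) ≤ C (sup_μ ‖Du(μ)‖²_{L¹(μ)+L^∞(μ)} + ‖u‖²_∞)` for all cylinder functions `u`, where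
`D` is the extrinsic derivative and `μ` ranges over the absolutely continuous finite measures.
There is no restriction on `u` for which the right-hand side is infinite. -/
def ExtDerivBound {M : Type*} [TopologicalSpace M] [MeasurableSpace M] {lam : Measure M}
    [SigmaFinite lam] {Λ : Measure (AcMeasure lam)} (𝓔 : L2Form Λ) (C : ℝ≥0) : Prop :=
  ∀ u : FiniteMeasure M → ℝ, IsCylinder u →
    𝓔.energy (fun μ => u μ.toFiniteMeasure) ≤
      C * ((⨆ μ : AcMeasure lam,
        normL1PlusLinf (extrinsicDeriv u μ.toFiniteMeasure) (μ.toFiniteMeasure : Measure M) ^ 2)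
          + supNorm u ^ 2)

/-- `𝓔(u, u) ≤ C (sup_μ ‖D̃u(μ)‖²_{L^∞(μ)} + ‖u‖²_∞)` for all cylinder functions `u`, where `D̃`
is the convexity extrinsic derivative and `μ` ranges over the absolutely continuous probability
measures. -/
def ConvExtDerivBound {M : Type*} [TopologicalSpace M] [MeasurableSpace M] {lam : Measure M}
    [SigmaFinite lam] {Λ : Measure (AcMeasure lam)} (𝓔 : L2Form Λ) (C : ℝ≥0) : Prop :=
  ∀ u : FiniteMeasure M → ℝ, IsCylinder u →
    𝓔.energy (fun μ => u μ.toFiniteMeasure) ≤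
      C * ((⨆ μ ∈ probAc lam,
        eLpNorm (convExtrinsicDeriv u μ.toFiniteMeasure) ∞ (μ.toFiniteMeasure : Measure M) ^ 2)
          + supNorm u ^ 2)

end

/-! Each derivative bound is used only through `HasCylinderBound`: a uniform energy bound for
cylinder functions `g(μ(f₀), …, μ(fₘ))` with `f₀ = 1`, `|fᵢ| ≤ 1`, `|g| ≤ 1` and `‖g'(y)‖ ≤ 1 / √(1
+ y₀²)`. Since `y₀` is the total mass of `μ`, this decay keeps even the `L¹(μ)` norm of the
extrinsic derivative bounded.

The functions that matter are the bounded distances `ρ / (√(1 + μ(M)²) + ρ)`, with `ρ` the total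
variation distance from `μ` to a fixed `ν`, and their minima over finitely many `ν`. Total variation
is a supremum of `μ(f) - ν(f)` over countably many continuous `f`, so replacing maxima and minima by
log-sum-exp yields cylinder functions of the above kind that converge pointwise to these minima.
Lower semicontinuity of the energy puts the minima into the domain with an energy bound independent
of the number of points (`HasCylinderBound.exists_minRelDist_mem`).

For a dense sequence of points the minima decrease to zero. Convex combinations of them tend to zero
in the `𝓔₁`-norm (`EnergySpace.exists_norm_lt_le`), and summing these along a subsequence bounds the
capacity of unions of superlevel sets (`IsDirichletForm.exists_tendsto_capOpen`). The complements of
the unions are closed and totally bounded (`totallyBounded_of_minRelDist_le`), hence compact by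
completeness: this is (Q1). The bounded distances to the dense points are continuous and separate
all points: this is (Q3). (Q2) is assumed. For probability measures everything is transported along
restriction to a closed set of full measure. -/

/-! ### Convex combinations of bounded sequences in a Hilbert space. -/

section ConvexCombinations

variable {H : Type*} [NormedAddCommGroup H] [InnerProductSpace ℝ H]

/-- In a Hilbert space, convex combinations of the tails of a bounded sequence can be chosen to
converge. -/
theorem exists_convexHull_tail_tendsto [CompleteSpace H] {u : ℕ → H} {c : ℝ}
    (hu : ∀ n, ‖u n‖ ≤ c) :
    ∃ (v : ℕ → H) (w : H), (∀ n, v n ∈ convexHull ℝ (u '' Ici n)) ∧ Tendsto v atTop (𝓝 w) := by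
  set K : ℕ → Set H := fun n => convexHull ℝ (u '' Ici n) with hK
  have hKne : ∀ n, (K n).Nonempty := fun n =>
    ⟨u n, subset_convexHull ℝ _ (mem_image_of_mem u self_mem_Ici)⟩
  have hKanti : ∀ {m n}, m ≤ n → K n ⊆ K m := fun h =>
    convexHull_mono (image_mono (Ici_subset_Ici.2 h))
  -- The distance from the origin to the hulls of the tails increases to a finite limit; nearly
  -- minimal elements of these hulls will form a Cauchy sequence.
  set d : ℕ → ℝ := fun n => Metric.infDist 0 (K n) with hd
  have hdmono : Monotone d := fun m n h => Metric.infDist_le_infDist_of_subset (hKanti h) (hKne n)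
  have hdle : ∀ n, ∀ x ∈ K n, d n ≤ ‖x‖ := fun n x hx => by
    simpa using Metric.infDist_le_dist_of_mem (x := (0 : H)) hx
  have hdc : ∀ n, d n ≤ c := fun n =>
    (hdle n _ (subset_convexHull ℝ _ (mem_image_of_mem u self_mem_Ici))).trans (hu n)
  have hd0 : ∀ n, 0 ≤ d n := fun n => Metric.infDist_nonneg
  obtain ⟨D, hD⟩ : ∃ D, Tendsto d atTop (𝓝 D) :=
    ⟨_, tendsto_atTop_ciSup hdmono ⟨c, by rintro _ ⟨n, rfl⟩; exact hdc n⟩⟩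
  have hdD : ∀ n, d n ≤ D := fun n => hdmono.ge_of_tendsto hD n
  have hex : ∀ n : ℕ, ∃ x ∈ K n, ‖x‖ < d n + 1 / ((n : ℝ) + 1) := fun n => by
    obtain ⟨x, hx, h⟩ := (Metric.infDist_lt_iff (hKne n)).1
      (lt_add_of_pos_right (d n) (Nat.one_div_pos_of_nat (α := ℝ) (n := n)))
    exact ⟨x, hx, by simpa using h⟩
  choose v hvK hv using hex
  -- Parallelogram law: the midpoint of `v m` and `v n` lies in `K n`, so its norm is at least `d
  -- n`.
  have hbound : ∀ n m, n ≤ m →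
      ‖v m - v n‖ ^ 2 ≤ 4 * ((D + 1 / ((n : ℝ) + 1)) ^ 2 - d n ^ 2) := by
    intro n m hnm
    have hpar := parallelogram_law_with_norm ℝ (v m) (v n)
    have hmid : d n ≤ ‖(1 / 2 : ℝ) • v m + (1 / 2 : ℝ) • v n‖ :=
      hdle n _ ((convex_convexHull ℝ _) (hKanti hnm (hvK m)) (hvK n)
        (by norm_num) (by norm_num) (by norm_num))
    rw [← smul_add, norm_smul, Real.norm_of_nonneg (by norm_num)] at hmid
    have hm : ‖v m‖ ≤ D + 1 / ((n : ℝ) + 1) :=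
      (hv m).le.trans (add_le_add (hdD m) (Nat.one_div_le_one_div hnm))
    have hn : ‖v n‖ ≤ D + 1 / ((n : ℝ) + 1) :=
      (hv n).le.trans (add_le_add (hdD n) le_rfl)
    have h1 := pow_le_pow_left₀ (norm_nonneg _) hm 2
    have h2 := pow_le_pow_left₀ (norm_nonneg _) hn 2
    have h3 := pow_le_pow_left₀ (hd0 n) hmid 2
    nlinarith
  have hlim : Tendsto (fun n : ℕ => √(4 * ((D + 1 / ((n : ℝ) + 1)) ^ 2 - d n ^ 2))) atTop
      (𝓝 0) := by
    have h := (((tendsto_const_nhds (x := D)).add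
      (tendsto_one_div_add_atTop_nhds_zero_nat (𝕜 := ℝ))).pow 2).sub (hD.pow 2)
    have h' := (h.const_mul 4).sqrt
    simpa using h'
  have hcauchy : CauchySeq v := by
    refine cauchySeq_of_le_tendsto_0' _ (fun n m hnm => ?_) hlim
    rw [dist_eq_norm, norm_sub_rev]
    exact Real.le_sqrt_of_sq_le (hbound n m hnm)
  obtain ⟨w, hw⟩ := cauchySeq_tendsto_of_complete hcauchy
  exact ⟨v, w, hvK, hw⟩

theorem tendsto_of_mem_convexHull_tail {F : Type*} [SeminormedAddCommGroup F] [NormedSpace ℝ F]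
    {u v : ℕ → F} {w : F} (hu : Tendsto u atTop (𝓝 w))
    (hv : ∀ n, v n ∈ convexHull ℝ (u '' Ici n)) : Tendsto v atTop (𝓝 w) := by
  rw [Metric.tendsto_atTop] at hu ⊢
  intro ε hε
  obtain ⟨N, hN⟩ := hu ε hε
  refine ⟨N, fun n hn => ?_⟩
  have : convexHull ℝ (u '' Ici n) ⊆ Metric.ball w ε := by
    refine convexHull_min ?_ (convex_ball w ε)
    rintro _ ⟨k, hk, rfl⟩
    exact hN k (hn.trans hk)
  exact this (hv n)

variable {F : Type*} [NormedAddCommGroup F] [NormedSpace ℝ F]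

/-- Plays the role of weak compactness, with `ι` the inclusion of the domain into `L²`. A linear map
sends hulls of tails to hulls of tails, which identifies the image of the limit; balls are convex,
which bounds its norm. -/
theorem exists_convexHull_tail_tendsto_of_map [CompleteSpace H] (ι : H →L[ℝ] F)
    {u : ℕ → H} {c : ℝ} (hu : ∀ n, ‖u n‖ ≤ c) {w : F}
    (hw : Tendsto (fun n => ι (u n)) atTop (𝓝 w)) :
    ∃ (v : ℕ → H) (x : H), (∀ n, v n ∈ convexHull ℝ (u '' Ici n)) ∧ Tendsto v atTop (𝓝 x) ∧
      ι x = w ∧ ‖x‖ ≤ c := by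
  obtain ⟨v, x, hv, hx⟩ := exists_convexHull_tail_tendsto hu
  refine ⟨v, x, hv, hx, ?_, ?_⟩
  · refine tendsto_nhds_unique ((ι.continuous.tendsto x).comp hx)
      (tendsto_of_mem_convexHull_tail hw fun n => ?_)
    have : ι (v n) ∈ ι '' convexHull ℝ (u '' Ici n) := mem_image_of_mem _ (hv n)
    rw [← ContinuousLinearMap.coe_coe, LinearMap.image_convexHull, image_image] at this
    exact this
  · refine le_of_tendsto hx.norm (Eventually.of_forall fun n => ?_)
    have : convexHull ℝ (u '' Ici n) ⊆ Metric.closedBall 0 c := by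
      refine convexHull_min ?_ (convex_closedBall 0 c)
      rintro _ ⟨k, -, rfl⟩
      simpa using hu k
    simpa using this (hv n)

end ConvexCombinations

theorem MeasureTheory.Lp.smul_le_smul_of_nonneg {E : Type*} [MeasurableSpace E] {Λ : Measure E}
    {p : ℝ≥0∞} {u v : Lp ℝ p Λ} (huv : u ≤ v) {a : ℝ} (ha : 0 ≤ a) : a • u ≤ a • v := by
  rw [← Lp.coeFn_le] at huv ⊢
  filter_upwards [huv, Lp.coeFn_smul a u, Lp.coeFn_smul a v] with z hz h1 h2
  rw [h1, h2]
  exact mul_le_mul_of_nonneg_left hz ha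

/-! ### The domain as a Hilbert space and its closedness under bounded `L²` limits. -/

namespace L2Form

variable {E : Type*} [MeasurableSpace E] {Λ : Measure E} {𝓔 : L2Form Λ}

/-- The domain of a Dirichlet form, with the Hilbert space structure given by `𝓔₁`. -/
def EnergySpace (_ : 𝓔.IsDirichletForm) : Type _ := 𝓔.domain

namespace EnergySpace

variable {h : 𝓔.IsDirichletForm}

noncomputable instance : AddCommGroup (EnergySpace h) := inferInstanceAs (AddCommGroup 𝓔.domain)

noncomputable instance : Module ℝ (EnergySpace h) := inferInstanceAs (Module ℝ 𝓔.domain)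

/-- The identification of the domain with its underlying linear space. -/
noncomputable def ofDomain (h : 𝓔.IsDirichletForm) : 𝓔.domain ≃ₗ[ℝ] EnergySpace h :=
  LinearEquiv.refl ℝ 𝓔.domain

/-- The inclusion of the domain into `L²`. -/
noncomputable def toLp (h : 𝓔.IsDirichletForm) : EnergySpace h →ₗ[ℝ] Lp ℝ 2 Λ :=
  𝓔.domain.subtype ∘ₗ (ofDomain h).symm.toLinearMap

theorem toLp_injective : Function.Injective (toLp h) :=
  𝓔.domain.subtype_injective.comp (ofDomain h).symm.injective

/-- The inner product `𝓔₁`. -/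
@[reducible]
noncomputable def innerCore (h : 𝓔.IsDirichletForm) : InnerProductSpace.Core ℝ (EnergySpace h) where
  inner u v := 𝓔.form ((ofDomain h).symm u) ((ofDomain h).symm v) + inner ℝ (toLp h u) (toLp h v)
  conj_inner_symm u v := by
    rw [real_inner_comm, h.symm]
    rfl
  re_inner_nonneg u := add_nonneg (h.nonneg _) real_inner_self_nonneg
  add_left u v w := by
    simp only [map_add, inner_add_left, LinearMap.add_apply]
    ring
  smul_left u v r := by
    simp only [map_smul, real_inner_smul_left, LinearMap.smul_apply, conj_trivial, smul_eq_mul]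
    ring
  definite u hu := by
    have h1 := h.nonneg ((ofDomain h).symm u)
    have h2 : inner ℝ (toLp h u) (toLp h u) = 0 :=
      le_antisymm (by linarith) real_inner_self_nonneg
    exact toLp_injective ((inner_self_eq_zero.1 h2).trans (map_zero _).symm)

noncomputable instance : NormedAddCommGroup (EnergySpace h) := (innerCore h).toNormedAddCommGroup

noncomputable instance : InnerProductSpace ℝ (EnergySpace h) := InnerProductSpace.ofCore _

theorem norm_sq (u : EnergySpace h) : ‖u‖ ^ 2 = 𝓔.energyOne ((ofDomain h).symm u) := by
  rw [← real_inner_self_eq_norm_sq, energyOne.eq_def, ← real_inner_self_eq_norm_sq]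
  rfl

theorem norm_ofDomain_sq (u : 𝓔.domain) : ‖ofDomain h u‖ ^ 2 = 𝓔.energyOne u := by
  rw [norm_sq, LinearEquiv.symm_apply_apply]

instance : CompleteSpace (EnergySpace h) := by
  refine Metric.complete_of_cauchySeq_tendsto fun u hu => ?_
  obtain ⟨v, hv⟩ := h.complete (fun n => (ofDomain h).symm (u n)) fun ε hε => by
    obtain ⟨N, hN⟩ := Metric.cauchySeq_iff.1 hu (√ε) (Real.sqrt_pos.2 hε)
    refine ⟨N, fun m hm n hn => ?_⟩
    have := hN m hm n hn
    rwa [dist_eq_norm, Real.lt_sqrt (norm_nonneg _), norm_sq, map_sub] at this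
  refine ⟨ofDomain h v, tendsto_iff_norm_sub_tendsto_zero.2 ?_⟩
  have h1 : Tendsto (fun n => ‖u n - ofDomain h v‖ ^ 2) atTop (𝓝 0) := by
    simpa only [norm_sq, map_sub, LinearEquiv.symm_apply_apply] using hv
  simpa using h1.sqrt

/-- The inclusion of the domain into `L²` as a continuous linear map. -/
noncomputable def toLpL (h : 𝓔.IsDirichletForm) : EnergySpace h →L[ℝ] Lp ℝ 2 Λ :=
  (toLp h).mkContinuous 1 fun u => by
    rw [one_mul, ← abs_norm u, ← abs_norm (toLp h u)]
    refine sq_le_sq.1 ?_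
    rw [norm_sq]
    exact le_add_of_nonneg_left (h.nonneg _)

theorem toLpL_injective : Function.Injective (toLpL h) := toLp_injective

theorem toLpL_ofDomain (u : 𝓔.domain) : toLpL h (ofDomain h u) = u := rfl

theorem coe_ofDomain_symm (u : EnergySpace h) :
    (((ofDomain h).symm u : 𝓔.domain) : Lp ℝ 2 Λ) = toLpL h u := rfl

end EnergySpace

theorem energyOne_nonneg (h : 𝓔.IsDirichletForm) (u : 𝓔.domain) : 0 ≤ 𝓔.energyOne u :=
  add_nonneg (h.nonneg u) (sq_nonneg _)

/-- Lower semicontinuity: `L²` limits of sequences with bounded `𝓔₁` belong to the domain. -/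
theorem IsDirichletForm.exists_mem_domain_of_tendsto (h : 𝓔.IsDirichletForm) {u : ℕ → 𝓔.domain}
    {c : ℝ} (hu : ∀ n, 𝓔.energyOne (u n) ≤ c) {w : Lp ℝ 2 Λ}
    (hw : Tendsto (fun n => (u n : Lp ℝ 2 Λ)) atTop (𝓝 w)) :
    ∃ x : 𝓔.domain, (x : Lp ℝ 2 Λ) = w ∧ 𝓔.energyOne x ≤ c := by
  have hc : 0 ≤ c := (energyOne_nonneg h (u 0)).trans (hu 0)
  obtain ⟨v, x, -, -, hx, hxc⟩ := exists_convexHull_tail_tendsto_of_map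
    (EnergySpace.toLpL h) (u := fun n => EnergySpace.ofDomain h (u n)) (c := √c)
    (fun n => Real.le_sqrt_of_sq_le (by rw [EnergySpace.norm_ofDomain_sq]; exact hu n)) hw
  refine ⟨(EnergySpace.ofDomain h).symm x, hx, ?_⟩
  rwa [Real.le_sqrt (norm_nonneg _) hc, EnergySpace.norm_sq] at hxc

/-- A decreasing sequence in the domain with bounded `𝓔₁` that tends to zero in `L²` is eventually
dominated by elements of small `𝓔₁`-norm. -/
theorem EnergySpace.exists_norm_lt_le {h : 𝓔.IsDirichletForm} {F : ℕ → EnergySpace h} {c : ℝ}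
    (hc : ∀ n, ‖F n‖ ≤ c) (hanti : Antitone fun n => toLpL h (F n))
    (hlim : Tendsto (fun n => toLpL h (F n)) atTop (𝓝 0)) {δ : ℝ} (hδ : 0 < δ) :
    ∃ (N : ℕ) (v : EnergySpace h), ‖v‖ < δ ∧ toLpL h (F N) ≤ toLpL h v := by
  obtain ⟨v, x, hv, hvx, hx, -⟩ := exists_convexHull_tail_tendsto_of_map (toLpL h) hc hlim
  have hx0 : x = 0 := toLpL_injective (hx.trans (map_zero _).symm)
  rw [hx0] at hvx
  obtain ⟨n, hn⟩ := (hvx.norm.eventually_lt_const (by simpa using hδ)).exists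
  -- Because the sequence decreases, the elements dominating one of its members form a convex set.
  -- It contains every `F k`, hence also `v n`.
  suffices hs : v n ∈ {y : EnergySpace h | ∃ N, toLpL h (F N) ≤ toLpL h y} by
    obtain ⟨N, hN⟩ := hs
    exact ⟨N, v n, hn, hN⟩
  refine convexHull_min ?_ ?_ (hv n)
  · rintro _ ⟨k, -, rfl⟩
    exact ⟨k, le_rfl⟩
  · rintro y ⟨N, hN⟩ z ⟨N', hN'⟩ a b ha hb hab
    refine ⟨max N N', ?_⟩
    rw [map_add, map_smul, map_smul]
    calc toLpL h (F (max N N'))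
        = a • toLpL h (F (max N N')) + b • toLpL h (F (max N N')) := by
          rw [← add_smul, hab, one_smul]
      _ ≤ a • toLpL h y + b • toLpL h z := add_le_add
          (Lp.smul_le_smul_of_nonneg ((hanti (le_max_left N N')).trans hN) ha)
          (Lp.smul_le_smul_of_nonneg ((hanti (le_max_right N N')).trans hN') hb)

end L2Form

/-! ### Capacity estimates. -/

namespace L2Form

variable {E : Type*} [MeasurableSpace E] {Λ : Measure E} {𝓔 : L2Form Λ}

/-- For a decreasing sequence of nonnegative functions in the domain with bounded `𝓔₁` that tends
to zero in `L²`, the unions of the superlevel sets of a suitable subsequence have vanishing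
capacity. -/
theorem IsDirichletForm.exists_tendsto_capOpen (h : 𝓔.IsDirichletForm) {F : ℕ → 𝓔.domain}
    {f : ℕ → E → ℝ} (hFf : ∀ n, (F n : Lp ℝ 2 Λ) =ᵐ[Λ] f n) {c : ℝ}
    (hc : ∀ n, 𝓔.energyOne (F n) ≤ c) (hf0 : ∀ n z, 0 ≤ f n z) (hanti : Antitone f)
    (hlim : Tendsto (fun n => (F n : Lp ℝ 2 Λ)) atTop (𝓝 0)) :
    ∃ N : ℕ → ℕ, Tendsto
      (fun l : ℕ => 𝓔.capOpen {z | ∃ j ≥ l, 1 / ((j : ℝ) + 1) < f (N j) z}) atTop (𝓝 0) := by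
  -- After scaling by `j + 1`, which lifts the level `1 / (j + 1)` to `1`, the dominating elements
  -- still have the summable norms `2⁻ʲ`.
  have hδ : ∀ j : ℕ, 0 < (1 / 2 : ℝ) ^ j / ((j : ℝ) + 1) := fun j => by positivity
  have hantiF : Antitone fun n => (F n : Lp ℝ 2 Λ) := fun m n hmn => by
    rw [← Lp.coeFn_le]
    filter_upwards [hFf m, hFf n] with z h1 h2
    rw [h1, h2]
    exact hanti hmn z
  choose N v hv hFv using fun j => EnergySpace.exists_norm_lt_le (h := h)
    (F := fun n => EnergySpace.ofDomain h (F n)) (c := √c)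
    (fun n => Real.le_sqrt_of_sq_le (by rw [EnergySpace.norm_ofDomain_sq]; exact hc n))
    hantiF hlim (hδ j)
  have hv0 : ∀ j, 0 ≤ EnergySpace.toLpL h (v j) := fun j => by
    refine le_trans ?_ (hFv j)
    rw [EnergySpace.toLpL_ofDomain, ← Lp.coeFn_nonneg]
    filter_upwards [hFf (N j)] with z hz
    rw [hz]
    exact hf0 _ z
  set x : ℕ → EnergySpace h := fun j => ((j : ℝ) + 1) • v j with hx
  have hx0 : ∀ j, 0 ≤ EnergySpace.toLpL h (x j) := fun j => by
    rw [hx, map_smul]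
    simpa using Lp.smul_le_smul_of_nonneg (hv0 j) (a := (j : ℝ) + 1) (by positivity)
  have hxs : Summable x := by
    refine Summable.of_norm_bounded (g := fun j : ℕ => (1 / 2 : ℝ) ^ j)
      summable_geometric_two fun j => ?_
    have hj : (0 : ℝ) < (j : ℝ) + 1 := by positivity
    rw [hx, norm_smul, Real.norm_of_nonneg hj.le, mul_comm, ← le_div_iff₀ hj]
    exact (hv j).le
  refine ⟨N, ?_⟩
  -- All terms are nonnegative, so the tail of the series dominates each of them and is at least `1`
  -- on the whole union; its norm tends to zero.
  set w : ℕ → EnergySpace h := fun l => ∑' j, x (j + l) with hw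
  have hwlim : Tendsto (fun l => ENNReal.ofReal (‖w l‖ ^ 2)) atTop (𝓝 0) := by
    have := ((tendsto_sum_nat_add x).norm.pow 2)
    simpa using ENNReal.tendsto_ofReal this
  refine tendsto_of_tendsto_of_tendsto_of_le_of_le tendsto_const_nhds hwlim
    (fun _ => zero_le) fun l => ?_
  rw [EnergySpace.norm_sq]
  refine iInf₂_le _ ?_
  have hle : ∀ j ≥ l, ((j : ℝ) + 1) • (F (N j) : Lp ℝ 2 Λ) ≤ EnergySpace.toLpL h (w l) := by
    intro j hj
    have hs : Summable fun j => x (j + l) := (summable_nat_add_iff l).2 hxs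
    rw [hw, ContinuousLinearMap.map_tsum _ hs]
    refine le_trans ?_ ((hs.mapL (EnergySpace.toLpL h)).le_tsum (j - l) fun k _ => hx0 _)
    rw [Nat.sub_add_cancel hj, hx, map_smul]
    exact Lp.smul_le_smul_of_nonneg (hFv j) (by positivity)
  have hae : ∀ j ≥ l, ∀ᵐ z ∂Λ, ((j : ℝ) + 1) * f (N j) z ≤ EnergySpace.toLpL h (w l) z := by
    intro j hj
    have := (Lp.coeFn_le _ _).2 (hle j hj)
    filter_upwards [this, hFf (N j), Lp.coeFn_smul ((j : ℝ) + 1) (F (N j) : Lp ℝ 2 Λ)]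
      with z h1 h2 h3
    rw [h3, Pi.smul_apply, h2, smul_eq_mul] at h1
    exact h1
  have hall : ∀ᵐ z ∂Λ, ∀ j ≥ l,
      ((j : ℝ) + 1) * f (N j) z ≤ EnergySpace.toLpL h (w l) z := by
    rw [ae_all_iff]
    intro j
    by_cases hj : j ≥ l
    · filter_upwards [hae j hj] with z hz _ using hz
    · exact Eventually.of_forall fun z hj' => absurd hj' hj
  filter_upwards [hall] with z hz
  rintro ⟨j, hj, hzj⟩
  rw [EnergySpace.coe_ofDomain_symm]
  refine le_trans ?_ (hz j hj)
  rw [div_lt_iff₀ (by positivity)] at hzj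
  linarith

/-- An infimum over the empty set is `∞`, so a finite bound produces a representative. The slack `1`
makes the inequality strict, as extracting a witness from an infimum requires. -/
theorem exists_of_energy_le {f : E → ℝ} {c : ℝ≥0} (hf : 𝓔.energy f ≤ c) :
    ∃ u : 𝓔.domain, ((u : Lp ℝ 2 Λ) =ᵐ[Λ] f) ∧ 𝓔.form u u ≤ c + 1 := by
  have h1 : 𝓔.energy f < ((c + 1 : ℝ≥0) : ℝ≥0∞) :=
    hf.trans_lt (by exact_mod_cast lt_add_one c)
  simp only [energy, iInf_lt_iff] at h1
  obtain ⟨u, hu, hlt⟩ := h1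
  refine ⟨u, hu, ?_⟩
  rw [← ENNReal.ofReal_coe_nnreal, ENNReal.ofReal_lt_ofReal_iff'] at hlt
  simpa using hlt.1.le

theorem capOpen_empty (𝓔 : L2Form Λ) : 𝓔.capOpen ∅ = 0 := by
  refine le_antisymm ((iInf₂_le (0 : 𝓔.domain) (by simp)).trans ?_) zero_le
  simp [energyOne]

theorem cap_le_capOpen [TopologicalSpace E] (𝓔 : L2Form Λ) {A O : Set E} (hO : IsOpen O)
    (hAO : A ⊆ O) : 𝓔.cap A ≤ 𝓔.capOpen O :=
  iInf_le_of_le O (iInf₂_le hO hAO)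

theorem cap_empty [TopologicalSpace E] (𝓔 : L2Form Λ) : 𝓔.cap ∅ = 0 :=
  le_antisymm ((𝓔.cap_le_capOpen isOpen_empty Subset.rfl).trans_eq 𝓔.capOpen_empty) zero_le

theorem quasiContinuous_of_continuous [TopologicalSpace E] [OpensMeasurableSpace E]
    (𝓔 : L2Form Λ) {f : E → ℝ} (hf : Continuous f) : 𝓔.QuasiContinuous f :=
  ⟨hf.measurable, fun _ => univ, ⟨fun _ => isClosed_univ, by simp [cap_empty]⟩,
    fun _ => hf.continuousOn⟩

end L2Form

/-- Bounded convergence in `L²`. -/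
theorem tendsto_toLp_two_of_bounded {E : Type*} [MeasurableSpace E] {Λ : Measure E}
    [IsFiniteMeasure Λ] {u : ℕ → Lp ℝ 2 Λ} {w : Lp ℝ 2 Λ} {f : ℕ → E → ℝ} {g : E → ℝ}
    (hu : ∀ n, u n =ᵐ[Λ] f n) (hw : w =ᵐ[Λ] g) {B : ℝ} (hB : ∀ n z, |f n z| ≤ B)
    (hlim : ∀ z, Tendsto (fun n => f n z) atTop (𝓝 (g z))) : Tendsto u atTop (𝓝 w) := by
  have hae : ∀ᵐ z ∂Λ, ∀ n, u n z = f n z := ae_all_iff.2 hu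
  have hgB : ∀ z, |g z| ≤ B := fun z =>
    le_of_tendsto (hlim z).abs (Eventually.of_forall fun n => hB n z)
  rw [tendsto_iff_norm_sub_tendsto_zero]
  have hint : Tendsto (fun n => ∫ z, ((u n - w : Lp ℝ 2 Λ) z) ^ 2 ∂Λ) atTop (𝓝 0) := by
    have := tendsto_integral_of_dominated_convergence (μ := Λ)
      (F := fun n z => (u n z - w z) ^ 2) (f := fun _ => 0) (fun _ => (2 * B) ^ 2)
      (fun n => ((Lp.aestronglyMeasurable (u n)).sub (Lp.aestronglyMeasurable w)).pow 2)
      (integrable_const _) (fun n => ?_) ?_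
    · rw [integral_zero] at this
      refine this.congr fun n => integral_congr_ae ?_
      filter_upwards [Lp.coeFn_sub (u n) w] with z hz
      rw [hz, Pi.sub_apply]
    · filter_upwards [hae, hw] with z h1 h2
      rw [h1, h2, norm_pow]
      refine pow_le_pow_left₀ (norm_nonneg _) ?_ 2
      calc ‖f n z - g z‖ ≤ |f n z| + |g z| := abs_sub _ _
        _ ≤ 2 * B := by linarith [hB n z, hgB z]
    · filter_upwards [hae, hw] with z h1 h2
      simp_rw [h1, h2]
      simpa using ((hlim z).sub_const (g z)).pow 2
  have hnorm : ∀ v : Lp ℝ 2 Λ, ‖v‖ = √(∫ z, (v z) ^ 2 ∂Λ) := fun v => by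
    rw [norm_eq_sqrt_real_inner, L2.inner_def]
    congr 2
    ext z
    simp [sq]
  simp_rw [hnorm]
  simpa using hint.sqrt

/-! ### The total variation metric: completeness, separability, duality with continuous functions.
-/

namespace AcMeasure

variable {M : Type*} [MeasurableSpace M] {lam : Measure M}

/-- The integral `μ(φ)` of a function against an absolutely continuous measure. -/
noncomputable def eval (μ : AcMeasure lam) (φ : M → ℝ) : ℝ :=
  ∫ x, φ x ∂(μ.toFiniteMeasure : Measure M)

instance : Nonempty (AcMeasure lam) :=
  ⟨⟨0, by simp [Measure.AbsolutelyContinuous.zero]⟩⟩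

theorem measurable_density (μ : AcMeasure lam) : Measurable μ.density :=
  (Measure.measurable_rnDeriv _ _).ennreal_toReal

theorem integrable_density_mul (μ : AcMeasure lam) {φ : M → ℝ} (hφ : Measurable φ)
    (h1 : ∀ x, |φ x| ≤ 1) : Integrable (fun x => μ.density x * φ x) lam :=
  μ.integrable_density.mul_bdd hφ.aestronglyMeasurable (Eventually.of_forall h1)

section SigmaFinite

variable [SigmaFinite lam]

theorem eval_eq (μ : AcMeasure lam) (φ : M → ℝ) : μ.eval φ = ∫ x, μ.density x * φ x ∂lam :=
  (integral_rnDeriv_smul μ.ac).symm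

theorem eval_sub_eval (μ ν : AcMeasure lam) {φ : M → ℝ} (hφ : Measurable φ)
    (h1 : ∀ x, |φ x| ≤ 1) :
    μ.eval φ - ν.eval φ = ∫ x, (μ.density x - ν.density x) * φ x ∂lam := by
  rw [eval_eq, eval_eq, ← integral_sub (μ.integrable_density_mul hφ h1)
    (ν.integrable_density_mul hφ h1)]
  simp only [sub_mul]

theorem abs_eval_sub_eval_le (μ ν : AcMeasure lam) {φ : M → ℝ} (hφ : Measurable φ)
    (h1 : ∀ x, |φ x| ≤ 1) : |μ.eval φ - ν.eval φ| ≤ dist μ ν := by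
  rw [eval_sub_eval μ ν hφ h1, dist_def]
  refine (abs_integral_le_integral_abs).trans
    (integral_mono_of_nonneg (Eventually.of_forall fun x => abs_nonneg _)
      (integrable_abs_sub μ ν) (Eventually.of_forall fun x => ?_))
  simp only [abs_mul]
  exact mul_le_of_le_one_right (abs_nonneg _) (h1 x)

/-- The density as an element of `L¹`. -/
noncomputable def toL1 (μ : AcMeasure lam) : Lp ℝ 1 lam := μ.integrable_density.toL1 _

theorem isometry_toL1 : Isometry (toL1 : AcMeasure lam → Lp ℝ 1 lam) :=
  Isometry.of_dist_eq fun μ ν => by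
    rw [dist_eq_norm, toL1, toL1, ← Integrable.toL1_sub, L1.norm_of_fun_eq_integral_norm, dist_def]
    rfl

/-- The positive cone is closed in `L¹`, whence completeness of the space of measures, which later
upgrades total boundedness to compactness. -/
theorem range_toL1 : range (toL1 : AcMeasure lam → Lp ℝ 1 lam) = Ici 0 := by
  ext f
  constructor
  · rintro ⟨μ, rfl⟩
    rw [mem_Ici, ← Lp.coeFn_nonneg]
    filter_upwards [μ.integrable_density.coeFn_toL1] with x hx
    rw [toL1, hx]
    exact ENNReal.toReal_nonneg
  · intro hf
    rw [mem_Ici, ← Lp.coeFn_nonneg] at hf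
    have hfin : IsFiniteMeasure (lam.withDensity fun x => ENNReal.ofReal (f x)) :=
      isFiniteMeasure_withDensity_ofReal (L1.integrable_coeFn f).2
    refine ⟨⟨⟨_, hfin⟩, withDensity_absolutelyContinuous _ _⟩, ?_⟩
    refine Lp.ext ?_
    refine (Integrable.coeFn_toL1 _).trans ?_
    have := Measure.rnDeriv_withDensity₀ lam
      (Lp.aestronglyMeasurable f).aemeasurable.ennreal_ofReal
    filter_upwards [this, hf] with x hx h0
    simp only [density, FiniteMeasure.toMeasure_mk, hx]
    exact ENNReal.toReal_ofReal h0

instance : CompleteSpace (AcMeasure lam) := by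
  rw [completeSpace_iff_isComplete_range isometry_toL1.isUniformInducing, range_toL1]
  exact isClosed_Ici.isComplete

instance [MeasurableSpace.CountablyGenerated M] : SecondCountableTopology (AcMeasure lam) :=
  have : Fact ((1 : ℝ≥0∞) ≠ ∞) := ⟨ENNReal.one_ne_top⟩
  isometry_toL1.isEmbedding.secondCountableTopology

end SigmaFinite

variable [TopologicalSpace M] [PolishSpace M] [BorelSpace M] [SigmaFinite lam]

/-- The total variation distance is a supremum over continuous functions. -/
theorem exists_dist_sub_le_eval (μ ν : AcMeasure lam) {ε : ℝ} (hε : 0 < ε) :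
    -- The sign of the difference of the densities attains the distance; it is approximated in `L¹(μ
    -- + ν)` by a continuous function.
    ∃ f : M →ᵇ ℝ, (∀ x, |f x| ≤ 1) ∧ dist μ ν - ε ≤ μ.eval f - ν.eval f := by
  classical
  set s : M → ℝ := fun x => if ν.density x ≤ μ.density x then 1 else -1 with hs
  have hsm : Measurable s :=
    Measurable.ite (measurableSet_le ν.measurable_density μ.measurable_density)
      measurable_const measurable_const
  have hs1 : ∀ x, |s x| ≤ 1 := fun x => by simp only [hs]; split_ifs <;> simp
  have hsd : dist μ ν = μ.eval s - ν.eval s := by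
    rw [eval_sub_eval μ ν hsm hs1, dist_def]
    congr 1
    ext x
    simp only [hs]
    split_ifs with hx
    · rw [abs_of_nonneg (sub_nonneg.2 hx), mul_one]
    · rw [abs_of_neg (by linarith)]; ring
  have hint : ∀ (κ : Measure M) [IsFiniteMeasure κ] (φ : M → ℝ), Measurable φ →
      (∀ x, |φ x| ≤ 1) → Integrable φ κ := fun κ _ φ hφ h1 =>
    Integrable.of_bound hφ.aestronglyMeasurable 1 (Eventually.of_forall h1)
  let := TopologicalSpace.upgradeIsCompletelyMetrizable M
  obtain ⟨g, hg, -⟩ := (hint ((μ.toFiniteMeasure : Measure M) + ν.toFiniteMeasure) s hsm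
    hs1).exists_boundedContinuous_integral_sub_le hε
  set c : M → ℝ := fun x => max (-1) (min (g x) 1) with hc
  have hcc : Continuous c := continuous_const.max (g.continuous.min continuous_const)
  have hc1 : ∀ x, |c x| ≤ 1 := fun x =>
    abs_le.2 ⟨le_max_left _ _, max_le (by norm_num) (min_le_right _ _)⟩
  refine ⟨BoundedContinuousFunction.ofNormedAddCommGroup c hcc 1 hc1, hc1, ?_⟩
  -- Truncation to `[-1, 1]` is a contraction that fixes the values of `s`.
  have hcs : ∀ x, |s x - c x| ≤ |s x - g x| := fun x => by
    have h1 := hs1 x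
    rw [abs_le] at h1
    have : s x = max (-1) (min (s x) 1) := by rw [min_eq_left h1.2, max_eq_right h1.1]
    rw [this]
    nth_rewrite 2 [← this]
    calc |max (-1) (min (s x) 1) - c x| ≤ |min (s x) 1 - min (g x) 1| := by
          simpa [max_comm] using abs_max_sub_max_le_abs (min (s x) 1) (min (g x) 1) (-1)
      _ ≤ |s x - g x| := by simpa using abs_min_sub_min_le_max (s x) 1 (g x) 1
  have hle : ∀ κ : AcMeasure lam,
      |κ.eval s - κ.eval c| ≤ ∫ x, ‖s x - g x‖ ∂(κ.toFiniteMeasure : Measure M) := fun κ => by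
    rw [eval, eval, ← integral_sub (hint _ s hsm hs1) (hint _ c hcc.measurable hc1)]
    refine abs_integral_le_integral_abs.trans (integral_mono_of_nonneg
      (Eventually.of_forall fun x => abs_nonneg _) ?_ (Eventually.of_forall hcs))
    exact ((hint _ s hsm hs1).sub (g.integrable _)).norm
  have hsg : ∀ κ : AcMeasure lam,
      Integrable (fun x => ‖s x - g x‖) (κ.toFiniteMeasure : Measure M) := fun κ =>
    ((hint _ s hsm hs1).sub (g.integrable _)).norm
  rw [integral_add_measure (hsg μ) (hsg ν)] at hg
  have h1 := abs_le.1 (hle μ)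
  have h2 := abs_le.1 (hle ν)
  have : dist μ ν - ε ≤ μ.eval c - ν.eval c := by rw [hsd]; linarith
  exact this

/-- Countably many bounded continuous functions determine the total variation distance. -/
theorem exists_seq_dist_sub_le_eval (lam : Measure M) [SigmaFinite lam] :
    ∃ f : ℕ → (M →ᵇ ℝ), f 0 = 1 ∧ (∀ j x, |f j x| ≤ 1) ∧
      ∀ (μ ν : AcMeasure lam) (ε : ℝ), 0 < ε → ∃ j, dist μ ν - ε ≤ μ.eval (f j) - ν.eval (f j) := by
  set κ : ℕ → AcMeasure lam := TopologicalSpace.denseSeq (AcMeasure lam) with hκ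
  choose φ hφ1 hφ using fun (k l n : ℕ) =>
    exists_dist_sub_le_eval (κ k) (κ l) (Nat.one_div_pos_of_nat (α := ℝ) (n := n))
  set f : ℕ → (M →ᵇ ℝ) := fun j => Nat.casesOn j 1 fun i =>
    φ i.unpair.1 i.unpair.2.unpair.1 i.unpair.2.unpair.2 with hf
  have hf1 : ∀ j x, |f j x| ≤ 1 := by
    rintro (_ | j) x
    · simp [hf]
    · exact hφ1 _ _ _ x
  refine ⟨f, rfl, hf1, fun μ ν ε hε => ?_⟩
  -- Five errors: the approximation error once, and the distances of `μ` and `ν` to the dense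
  -- sequence twice each, in the triangle inequality and in the integrals.
  obtain ⟨n, hn⟩ := exists_nat_one_div_lt (show 0 < ε / 5 by linarith)
  obtain ⟨k, hk⟩ := (TopologicalSpace.denseRange_denseSeq (AcMeasure lam)).exists_dist_lt μ
    (show 0 < ε / 5 by linarith)
  obtain ⟨l, hl⟩ := (TopologicalSpace.denseRange_denseSeq (AcMeasure lam)).exists_dist_lt ν
    (show 0 < ε / 5 by linarith)
  refine ⟨Nat.pair k (Nat.pair l n) + 1, ?_⟩
  have hj : f (Nat.pair k (Nat.pair l n) + 1) = φ k l n := by simp [hf]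
  rw [hj]
  have h0 := hφ k l n
  have h1 := abs_le.1 (abs_eval_sub_eval_le μ (κ k) (φ k l n).continuous.measurable (hφ1 k l n))
  have h2 := abs_le.1 (abs_eval_sub_eval_le ν (κ l) (φ k l n).continuous.measurable (hφ1 k l n))
  have h3 := dist_triangle4_right μ ν (κ k) (κ l)
  linarith [h1.1, h2.2]

end AcMeasure

/-! ### Log-sum-exp as a smooth maximum. -/

section SmoothMax

/-- The smooth maximum `β⁻¹ log ∑ᵢ exp(β hᵢ)`. -/
noncomputable def smoothMax {ι : Type*} [Fintype ι] (β : ℝ) (h : ι → ℝ) : ℝ :=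
  β⁻¹ * Real.log (∑ i, Real.exp (β * h i))

variable {ι : Type*} [Fintype ι] {β : ℝ}

theorem le_smoothMax (hβ : 0 < β) (h : ι → ℝ) (i : ι) : h i ≤ smoothMax β h := by
  have h1 : Real.exp (β * h i) ≤ ∑ i, Real.exp (β * h i) :=
    Finset.single_le_sum (f := fun i => Real.exp (β * h i)) (fun j _ => (Real.exp_pos _).le)
      (Finset.mem_univ i)
  have h2 := Real.log_le_log (Real.exp_pos _) h1
  rw [Real.log_exp] at h2
  rw [smoothMax, inv_mul_eq_div, le_div_iff₀ hβ]
  linarith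

variable [Nonempty ι]

theorem sum_exp_pos (h : ι → ℝ) : 0 < ∑ i, Real.exp (h i) :=
  Finset.sum_pos (fun _ _ => Real.exp_pos _) Finset.univ_nonempty

theorem smoothMax_le (hβ : 0 < β) {h : ι → ℝ} {a : ℝ} (ha : ∀ i, h i ≤ a) :
    smoothMax β h ≤ a + Real.log (Fintype.card ι) / β := by
  have h1 : ∑ i, Real.exp (β * h i) ≤ Fintype.card ι * Real.exp (β * a) := by
    have := Finset.sum_le_card_nsmul Finset.univ (fun i => Real.exp (β * h i)) (Real.exp (β * a))
      fun i _ => Real.exp_le_exp.2 (mul_le_mul_of_nonneg_left (ha i) hβ.le)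
    simpa using this
  have h2 := Real.log_le_log (sum_exp_pos _) h1
  rw [Real.log_mul (by simp) (Real.exp_pos _).ne', Real.log_exp] at h2
  rw [smoothMax, inv_mul_eq_div, div_le_iff₀ hβ, add_mul, div_mul_cancel₀ _ hβ.ne']
  linarith

variable {V : Type*} [NormedAddCommGroup V] [NormedSpace ℝ V] {h : ι → V → ℝ}

theorem contDiff_smoothMax (hh : ∀ i, ContDiff ℝ 1 (h i)) :
    ContDiff ℝ 1 fun y => smoothMax β fun i => h i y := by
  unfold smoothMax
  exact contDiff_const.mul ((ContDiff.sum fun i _ => (contDiff_const.mul (hh i)).exp).log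
    fun y => (sum_exp_pos _).ne')

/-- The derivative is a convex combination of the derivatives of the `h i`, with weights
proportional to `exp (β hᵢ)`; the bound therefore depends neither on `β` nor on the number of
functions. -/
theorem norm_fderiv_smoothMax_le (hβ : 0 < β) {y : V} {L : ℝ}
    (hh : ∀ i, DifferentiableAt ℝ (h i) y) (hL : ∀ i, ‖fderiv ℝ (h i) y‖ ≤ L) :
    ‖fderiv ℝ (fun y => smoothMax β fun i => h i y) y‖ ≤ L := by
  have hpos := sum_exp_pos fun i => β * h i y
  have hd : HasFDerivAt (fun y => smoothMax β fun i => h i y)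
      (β⁻¹ • (∑ i, Real.exp (β * h i y))⁻¹ •
        ∑ i, Real.exp (β * h i y) • β • fderiv ℝ (h i) y) y := by
    unfold smoothMax
    exact ((HasFDerivAt.fun_sum fun i _ =>
      ((hh i).hasFDerivAt.const_mul β).exp).log hpos.ne').const_mul β⁻¹
  rw [hd.fderiv, norm_smul, norm_smul, Real.norm_of_nonneg (inv_nonneg.2 hβ.le),
    Real.norm_of_nonneg (inv_nonneg.2 hpos.le), inv_mul_le_iff₀ hβ, inv_mul_le_iff₀ hpos,
    Finset.sum_mul]
  refine norm_sum_le_of_le _ fun i _ => ?_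
  rw [norm_smul, norm_smul, Real.norm_of_nonneg (Real.exp_pos _).le, Real.norm_of_nonneg hβ.le]
  exact mul_le_mul_of_nonneg_left (mul_le_mul_of_nonneg_left (hL i) hβ.le) (Real.exp_pos _).le

end SmoothMax

/-! ### Smooth versions of the bounded distances, as functions on `ℝᵐ⁺¹`. -/

section Approximants

variable {V : Type*} [NormedAddCommGroup V] [NormedSpace ℝ V]

/-- If `S > 0` and `T ≥ 0` have derivatives of norm at most one, then the derivative of
`T / (S + T)` has norm at most `1 / S`. -/
theorem norm_fderiv_div_add_le {S T : V → ℝ} {y : V} (hS : DifferentiableAt ℝ S y)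
    (hT : DifferentiableAt ℝ T y) (hS0 : 0 < S y) (hT0 : 0 ≤ T y) (hS1 : ‖fderiv ℝ S y‖ ≤ 1)
    (hT1 : ‖fderiv ℝ T y‖ ≤ 1) : ‖fderiv ℝ (fun y => T y / (S y + T y)) y‖ ≤ 1 / S y := by
  have hpos : 0 < S y + T y := by linarith
  have hinv : HasFDerivAt (fun y => (S y + T y)⁻¹)
      (-((S y + T y) ^ 2)⁻¹ • (fderiv ℝ S y + fderiv ℝ T y)) y :=
    (hasDerivAt_inv hpos.ne').comp_hasFDerivAt y (hS.hasFDerivAt.add hT.hasFDerivAt)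
  have hd := hT.hasFDerivAt.mul hinv
  -- The quotient has derivative `(S T' - T S') / (S + T)²`, of norm at most `1 / (S + T)`.
  have heq : T y • -((S y + T y) ^ 2)⁻¹ • (fderiv ℝ S y + fderiv ℝ T y)
      + (S y + T y)⁻¹ • fderiv ℝ T y
      = ((S y + T y) ^ 2)⁻¹ • (S y • fderiv ℝ T y - T y • fderiv ℝ S y) := by
    ext v
    simp only [add_apply, smul_apply, sub_apply, smul_eq_mul]
    field_simp
    ring
  rw [heq] at hd
  simp_rw [div_eq_mul_inv]
  change ‖fderiv ℝ (T * fun y => (S y + T y)⁻¹) y‖ ≤ _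
  rw [hd.fderiv, norm_smul, Real.norm_of_nonneg (by positivity), inv_mul_le_iff₀ (by positivity)]
  have h1 : ‖S y • fderiv ℝ T y - T y • fderiv ℝ S y‖ ≤ S y + T y := by
    refine (norm_sub_le _ _).trans ?_
    rw [norm_smul, norm_smul, Real.norm_of_nonneg hS0.le, Real.norm_of_nonneg hT0]
    exact add_le_add (mul_le_of_le_one_right hS0.le hT1) (mul_le_of_le_one_right hT0 hS1)
  refine h1.trans ?_
  rw [one_mul, ← div_eq_mul_inv, le_div_iff₀ hS0]
  nlinarith

variable {m : ℕ}

/-- The smooth weight `√(1 + t²)`. -/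
noncomputable def weight (t : ℝ) : ℝ := √(1 + t ^ 2)

theorem one_add_sq_pos (t : ℝ) : 0 < 1 + t ^ 2 := by positivity

theorem weight_pos (t : ℝ) : 0 < weight t := Real.sqrt_pos.2 (one_add_sq_pos t)

theorem one_le_weight (t : ℝ) : 1 ≤ weight t :=
  Real.one_le_sqrt.2 (by nlinarith [sq_nonneg t])

theorem abs_le_weight (t : ℝ) : |t| ≤ weight t := Real.abs_le_sqrt (by linarith)

theorem weight_le (t : ℝ) : weight t ≤ 1 + |t| := by
  refine Real.sqrt_le_iff.2 ⟨by positivity, ?_⟩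
  nlinarith [sq_abs t, abs_nonneg t]

theorem continuous_weight : Continuous weight := by
  unfold weight
  fun_prop

theorem contDiff_weight : ContDiff ℝ 1 weight :=
  (contDiff_const.add (contDiff_id.pow 2)).sqrt fun t => (one_add_sq_pos t).ne'

theorem norm_proj_le_one (j : Fin (m + 1)) :
    ‖ContinuousLinearMap.proj (R := ℝ) (φ := fun _ : Fin (m + 1) => ℝ) j‖ ≤ 1 :=
  ContinuousLinearMap.opNorm_le_bound _ zero_le_one fun x => by
    simpa using norm_le_pi_norm x j

theorem norm_fderiv_weight_le (y : Fin (m + 1) → ℝ) :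
    ‖fderiv ℝ (fun y : Fin (m + 1) → ℝ => weight (y 0)) y‖ ≤ 1 := by
  have h1 : HasDerivAt weight (y 0 / weight (y 0)) (y 0) := by
    have := (((hasDerivAt_id (y 0)).pow 2).const_add 1).sqrt (one_add_sq_pos (y 0)).ne'
    refine HasDerivAt.congr_deriv this ?_
    simp only [weight, id, Pi.pow_apply]
    field_simp
    simp
  have h2 := h1.comp_hasFDerivAt y (hasFDerivAt_apply (𝕜 := ℝ) (0 : Fin (m + 1)) y)
  change ‖fderiv ℝ (weight ∘ fun y : Fin (m + 1) → ℝ => y 0) y‖ ≤ 1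
  rw [h2.fderiv, norm_smul, Real.norm_eq_abs, abs_div, abs_of_pos (weight_pos _)]
  refine mul_le_one₀ ((div_le_one (weight_pos _)).2 (abs_le_weight _)) (norm_nonneg _) ?_
  exact norm_proj_le_one _

/-- A smooth approximation of `maxⱼ (yⱼ - aⱼ)⁺`. -/
noncomputable def smoothGap (β : ℝ) (a y : Fin (m + 1) → ℝ) : ℝ :=
  smoothMax β fun o : Option (Fin (m + 1)) => o.elim 0 fun j => y j - a j

variable {β : ℝ}

/-- The index `none` supplies the value `0` in the maximum; it also accounts for the `m + 2` in
`smoothGap_le`. -/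
theorem smoothGap_nonneg (hβ : 0 < β) (a y : Fin (m + 1) → ℝ) : 0 ≤ smoothGap β a y :=
  le_smoothMax hβ (fun o : Option (Fin (m + 1)) => o.elim 0 fun j => y j - a j) none

theorem sub_le_smoothGap (hβ : 0 < β) (a y : Fin (m + 1) → ℝ) (j : Fin (m + 1)) :
    y j - a j ≤ smoothGap β a y :=
  le_smoothMax hβ (fun o : Option (Fin (m + 1)) => o.elim 0 fun j => y j - a j) (some j)

theorem smoothGap_le (hβ : 0 < β) {a y : Fin (m + 1) → ℝ} {r : ℝ} (hr : 0 ≤ r)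
    (h : ∀ j, y j - a j ≤ r) : smoothGap β a y ≤ r + Real.log (m + 2) / β := by
  have := smoothMax_le (β := β) (h := fun o : Option (Fin (m + 1)) => o.elim 0 fun j => y j - a j)
    (a := r) hβ (by rintro (_ | j); exacts [hr, h j])
  simp only [Fintype.card_option, Fintype.card_fin] at this
  refine this.trans_eq ?_
  push_cast
  ring_nf

theorem contDiff_gapTerm (a : Fin (m + 1) → ℝ) (o : Option (Fin (m + 1))) :
    ContDiff ℝ 1 fun y : Fin (m + 1) → ℝ => (o.elim 0 fun j => y j - a j : ℝ) := by
  rcases o with _ | j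
  · exact contDiff_const
  · exact (contDiff_apply ℝ ℝ j).sub contDiff_const

theorem contDiff_smoothGap (a : Fin (m + 1) → ℝ) : ContDiff ℝ 1 (smoothGap β a) :=
  contDiff_smoothMax (contDiff_gapTerm a)

theorem norm_fderiv_smoothGap_le (hβ : 0 < β) (a y : Fin (m + 1) → ℝ) :
    ‖fderiv ℝ (smoothGap β a) y‖ ≤ 1 := by
  refine norm_fderiv_smoothMax_le hβ
    (fun o => (contDiff_gapTerm a o).differentiable one_ne_zero y) ?_
  rintro (_ | j)
  · simp
  · have : HasFDerivAt (fun y : Fin (m + 1) → ℝ => y j - a j) _ y :=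
      (hasFDerivAt_apply (𝕜 := ℝ) j y).sub_const (a j)
    simp only [Option.elim_some]
    rw [this.fderiv]
    exact norm_proj_le_one _

/-- The normalized gap `T / (S + T)`. -/
noncomputable def normalizedGap (β : ℝ) (a y : Fin (m + 1) → ℝ) : ℝ :=
  smoothGap β a y / (weight (y 0) + smoothGap β a y)

/-- The smooth approximation of the minimum over `k` of the normalized gaps `T / (S + T)`. -/
noncomputable def smoothMinGap {n : ℕ} (β : ℝ) (a : Fin (n + 1) → Fin (m + 1) → ℝ)
    (y : Fin (m + 1) → ℝ) : ℝ :=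
  -smoothMax β fun k => -normalizedGap β (a k) y

variable {n : ℕ}

theorem gap_denom_pos (hβ : 0 < β) (a y : Fin (m + 1) → ℝ) :
    0 < weight (y 0) + smoothGap β a y :=
  add_pos_of_pos_of_nonneg (weight_pos _) (smoothGap_nonneg hβ a y)

theorem contDiff_normalizedGap (hβ : 0 < β) (a : Fin (m + 1) → ℝ) :
    ContDiff ℝ 1 (normalizedGap β a) :=
  (contDiff_smoothGap a).div ((contDiff_weight.comp (contDiff_apply ℝ ℝ 0)).add
    (contDiff_smoothGap a)) fun y => (gap_denom_pos hβ a y).ne'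

theorem contDiff_smoothMinGap (hβ : 0 < β) (a : Fin (n + 1) → Fin (m + 1) → ℝ) :
    ContDiff ℝ 1 (smoothMinGap β a) :=
  (contDiff_smoothMax fun k => (contDiff_normalizedGap hβ (a k)).neg).neg

/-- This is the decay demanded by `HasCylinderBound`. Each normalized gap has it by the quotient
estimate, and smooth maxima preserve it, uniformly in `n`, `m` and `β`. -/
theorem norm_fderiv_smoothMinGap_le (hβ : 0 < β) (a : Fin (n + 1) → Fin (m + 1) → ℝ)
    (y : Fin (m + 1) → ℝ) : ‖fderiv ℝ (smoothMinGap β a) y‖ ≤ 1 / weight (y 0) := by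
  unfold smoothMinGap
  rw [fderiv_fun_neg, norm_neg]
  refine norm_fderiv_smoothMax_le hβ
    (fun k => (contDiff_normalizedGap hβ (a k)).neg.differentiable one_ne_zero y) fun k => ?_
  rw [fderiv_fun_neg, norm_neg]
  unfold normalizedGap
  have hS : DifferentiableAt ℝ (fun y : Fin (m + 1) → ℝ => weight (y 0)) y :=
    (contDiff_weight.comp (contDiff_apply ℝ ℝ 0)).differentiable one_ne_zero y
  have hT : DifferentiableAt ℝ (smoothGap β (a k)) y :=
    (contDiff_smoothGap (a k)).differentiable one_ne_zero y
  exact norm_fderiv_div_add_le hS hT (weight_pos _)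
    (smoothGap_nonneg hβ _ _) (norm_fderiv_weight_le y) (norm_fderiv_smoothGap_le hβ _ _)

theorem smoothMinGap_le (hβ : 0 < β) (a : Fin (n + 1) → Fin (m + 1) → ℝ)
    (y : Fin (m + 1) → ℝ) (k : Fin (n + 1)) :
    smoothMinGap β a y ≤ normalizedGap β (a k) y := by
  have := le_smoothMax hβ
    (fun k => -normalizedGap β (a k) y) k
  rw [smoothMinGap]
  linarith

theorem le_smoothMinGap (hβ : 0 < β) {a : Fin (n + 1) → Fin (m + 1) → ℝ}
    {y : Fin (m + 1) → ℝ} {r : ℝ}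
    (hr : ∀ k, r ≤ normalizedGap β (a k) y) :
    r - Real.log (n + 1) / β ≤ smoothMinGap β a y := by
  have := smoothMax_le (a := -r) hβ fun k => neg_le_neg (hr k)
  rw [Fintype.card_fin] at this
  push_cast at this
  rw [smoothMinGap]
  linarith

/-- The normalized gaps lie in `[0, 1]`, and `β ≥ n + 1` keeps the smoothing error `log (n + 1) / β`
below one. -/
theorem abs_smoothMinGap_le (hβ : (n : ℝ) + 1 ≤ β) (a : Fin (n + 1) → Fin (m + 1) → ℝ)
    (y : Fin (m + 1) → ℝ) : |smoothMinGap β a y| ≤ 1 := by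
  have hn : (0 : ℝ) < (n : ℝ) + 1 := by positivity
  have hβ0 : 0 < β := hn.trans_le hβ
  rw [abs_le]
  constructor
  · have h1 := le_smoothMinGap (r := 0) hβ0 (a := a) (y := y) fun k =>
      div_nonneg (smoothGap_nonneg hβ0 _ _) (gap_denom_pos hβ0 _ _).le
    have h2 : Real.log (n + 1) / β ≤ 1 := by
      rw [div_le_one hβ0]
      linarith [Real.log_le_sub_one_of_pos hn]
    linarith
  · refine (smoothMinGap_le hβ0 a y 0).trans ?_
    rw [normalizedGap, div_le_one (gap_denom_pos hβ0 _ _)]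
    linarith [weight_pos (y 0)]

end Approximants

/-! ### Extrinsic derivatives of cylinder functions. -/

section ExtrinsicDerivatives

variable {M : Type*} [TopologicalSpace M] [PolishSpace M] [MeasurableSpace M] [BorelSpace M]
  {n : ℕ} {f : Fin n → (M →ᵇ ℝ)} {g : (Fin n → ℝ) → ℝ}

theorem integral_smul_add_smul_dirac (φ : M →ᵇ ℝ) (μ : FiniteMeasure M) (x : M) (a b : ℝ≥0) :
    ∫ z, φ z ∂((a • μ + b • diracFin x : FiniteMeasure M) : Measure M) =
      a * ∫ z, φ z ∂(μ : Measure M) + b * φ x := by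
  have hi : ∀ κ : FiniteMeasure M, Integrable φ (κ : Measure M) := fun κ => φ.integrable _
  rw [FiniteMeasure.toMeasure_add, integral_add_measure (hi _) (hi _), FiniteMeasure.toMeasure_smul,
    FiniteMeasure.toMeasure_smul, integral_smul_nnreal_measure, integral_smul_nnreal_measure]
  have : ∫ z, φ z ∂((diracFin x : FiniteMeasure M) : Measure M) = φ x :=
    integral_dirac _ _
  rw [this]
  rfl

/-- Adding `ε δₓ` moves the vector of integrals along a straight line with velocity `(fᵢ(x))ᵢ`, so
the chain rule applies. -/
theorem extrinsicDeriv_cylinder (hg : Differentiable ℝ g) (μ : FiniteMeasure M) (x : M) :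
    extrinsicDeriv (fun μ => g fun i => ∫ z, f i z ∂(μ : Measure M)) μ x =
      fderiv ℝ g (fun i => ∫ z, f i z ∂(μ : Measure M)) fun i => f i x := by
  set y : Fin n → ℝ := fun i => ∫ z, f i z ∂(μ : Measure M) with hy
  set v : Fin n → ℝ := fun i => f i x with hv
  have hline : HasDerivAt (fun ε : ℝ => y + ε • v) v 0 := by
    simpa using ((hasDerivAt_id (0 : ℝ)).smul_const v).const_add y
  have hgd : HasFDerivAt g (fderiv ℝ g y) (y + (0 : ℝ) • v) := by
    simpa using (hg y).hasFDerivAt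
  have hd := (hgd.comp_hasDerivAt (0 : ℝ) hline).hasDerivWithinAt (s := Ici 0)
  refine HasDerivWithinAt.derivWithin (hd.congr_of_mem (fun ε hε => ?_) self_mem_Ici)
    (uniqueDiffOn_Ici 0 0 self_mem_Ici)
  refine congrArg g (funext fun i => ?_)
  have := integral_smul_add_smul_dirac (f i) μ x 1 ε.toNNReal
  rw [one_smul] at this
  rw [this, Real.coe_toNNReal _ hε]
  simp [hy, hv]

theorem convExtrinsicDeriv_cylinder (hg : Differentiable ℝ g) (μ : FiniteMeasure M) (x : M) :
    convExtrinsicDeriv (fun μ => g fun i => ∫ z, f i z ∂(μ : Measure M)) μ x =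
      fderiv ℝ g (fun i => ∫ z, f i z ∂(μ : Measure M))
        fun i => f i x - ∫ z, f i z ∂(μ : Measure M) := by
  set y : Fin n → ℝ := fun i => ∫ z, f i z ∂(μ : Measure M) with hy
  set v : Fin n → ℝ := fun i => f i x - ∫ z, f i z ∂(μ : Measure M) with hv
  have hline : HasDerivAt (fun ε : ℝ => y + ε • v) v 0 := by
    simpa using ((hasDerivAt_id (0 : ℝ)).smul_const v).const_add y
  have hgd : HasFDerivAt g (fderiv ℝ g y) (y + (0 : ℝ) • v) := by
    simpa using (hg y).hasFDerivAt
  have hd := (hgd.comp_hasDerivAt (0 : ℝ) hline).hasDerivWithinAt (s := Ici 0)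
  -- For `ε > 1` the coefficient `(1 - ε).toNNReal` is cut off at zero; agreement near `0` on the
  -- right is enough.
  have heq : ∀ ε ∈ Icc (0 : ℝ) 1,
      (g fun i => ∫ z, f i z
        ∂(((1 - ε).toNNReal • μ + ε.toNNReal • diracFin x : FiniteMeasure M) : Measure M)) =
      g (y + ε • v) := by
    rintro ε ⟨h0, h1⟩
    refine congrArg g (funext fun i => ?_)
    rw [integral_smul_add_smul_dirac, Real.coe_toNNReal _ h0, Real.coe_toNNReal _ (by linarith)]
    simp only [hy, hv, Pi.add_apply, Pi.smul_apply, smul_eq_mul]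
    ring
  refine HasDerivWithinAt.derivWithin (hd.congr_of_eventuallyEq ?_
    (heq 0 ⟨le_rfl, zero_le_one⟩)) (uniqueDiffOn_Ici 0 0 self_mem_Ici)
  have hmem : Icc (0 : ℝ) 1 ∈ 𝓝[≥] 0 := Icc_mem_nhdsGE zero_lt_one
  filter_upwards [hmem] with ε hε using heq ε hε

end ExtrinsicDerivatives

theorem supNorm_le_one {M : Type*} [MeasurableSpace M] {u : FiniteMeasure M → ℝ} (hu : ∀ μ, |u μ| ≤ 1) :
    supNorm u ^ 2 ≤ 1 := by
  refine pow_le_one₀ zero_le (iSup_le fun μ => ?_)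
  rw [← ofReal_norm]
  simpa using hu μ

/-! ### Both derivative bounds imply the uniform energy bound. -/

section CylinderBound

variable {M : Type*} [TopologicalSpace M] [MeasurableSpace M] {lam : Measure M} [SigmaFinite lam]
  {Λ : Measure (AcMeasure lam)}

/-- A uniform energy bound for the cylinder functions `g(μ(f₀), …, μ(fₘ))` with `f₀ = 1`,
`|fᵢ| ≤ 1`, `|g| ≤ 1` and `‖g'(y)‖ ≤ (1 + y₀²)^{-1/2}`. -/
def HasCylinderBound (𝓔 : L2Form Λ) (c : ℝ≥0) : Prop :=
  ∀ (m : ℕ) (f : Fin (m + 1) → (M →ᵇ ℝ)) (g : (Fin (m + 1) → ℝ) → ℝ), f 0 = 1 →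
    (∀ i x, |f i x| ≤ 1) → ContDiff ℝ 1 g → (∀ y, |g y| ≤ 1) →
    (∀ y, ‖fderiv ℝ g y‖ ≤ 1 / weight (y 0)) →
    𝓔.energy (fun μ => g fun i => μ.eval (f i)) ≤ c

variable {m : ℕ} {f : Fin (m + 1) → (M →ᵇ ℝ)} {g : (Fin (m + 1) → ℝ) → ℝ}

theorem isCylinder_of_bounds (hg : ContDiff ℝ 1 g) (hg1 : ∀ y, |g y| ≤ 1)
    (hg' : ∀ y, ‖fderiv ℝ g y‖ ≤ 1 / weight (y 0)) :
    IsCylinder fun μ : FiniteMeasure M => g fun i => ∫ x, f i x ∂(μ : Measure M) :=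
  ⟨m + 1, f, g, hg, ⟨1, fun y => ⟨hg1 y, (hg' y).trans
    ((div_le_one (weight_pos _)).2 (one_le_weight _))⟩⟩, fun _ => rfl⟩

variable [PolishSpace M] [BorelSpace M]

theorem ExtDerivBound.hasCylinderBound {𝓔 : L2Form Λ} {C : ℝ≥0} (h : ExtDerivBound 𝓔 C) :
    HasCylinderBound 𝓔 (C * 5) := by
  intro m f g hf0 hf1 hg hg1 hg'
  refine (h _ (isCylinder_of_bounds (f := f) hg hg1 hg')).trans ?_
  rw [ENNReal.coe_mul]
  gcongr
  -- The `L¹` and `L^∞` norms of the derivative are at most one each, giving `2²`; the supremum norm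
  -- gives the last `1`.
  have h5 : ((5 : ℝ≥0) : ℝ≥0∞) = 2 ^ 2 + 1 := by norm_num
  rw [h5]
  refine add_le_add (iSup_le fun μ => ?_) (supNorm_le_one fun μ => hg1 _)
  gcongr
  set κ : Measure M := (μ.toFiniteMeasure : Measure M)
  set y : Fin (m + 1) → ℝ := fun i => ∫ x, f i x ∂κ with hy
  set D : M → ℝ := extrinsicDeriv
    (fun μ : FiniteMeasure M => g fun i => ∫ x, f i x ∂(μ : Measure M)) μ.toFiniteMeasure
  have hy0 : y 0 = κ.real univ := by simp [hy, hf0]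
  have hD : ∀ x, ‖D x‖ ≤ 1 / weight (y 0) := fun x => by
    simp only [D]
    rw [extrinsicDeriv_cylinder (hg.differentiable one_ne_zero)]
    refine (ContinuousLinearMap.le_of_opNorm_le_of_le _ (hg' y)
      ((pi_norm_le_iff_of_nonneg zero_le_one).2 fun i => hf1 i x)).trans_eq (mul_one _)
  -- Mass times supremum is at most `y₀ / √(1 + y₀²)`.
  have h1 : eLpNorm D 1 κ ≤ 1 := by
    refine (eLpNorm_le_of_ae_bound (Eventually.of_forall hD)).trans ?_
    rw [ENNReal.toReal_one, inv_one, ENNReal.rpow_one, ← ofReal_measureReal,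
      ← ENNReal.ofReal_mul measureReal_nonneg, ← hy0, mul_one_div]
    refine ENNReal.ofReal_le_one.2 ((div_le_one (weight_pos _)).2 ?_)
    exact (le_abs_self _).trans (abs_le_weight _)
  have h2 : eLpNorm D ∞ κ ≤ 1 := by
    rw [eLpNorm_exponent_top]
    refine (eLpNormEssSup_le_of_ae_bound (Eventually.of_forall hD)).trans ?_
    exact ENNReal.ofReal_le_one.2 ((div_le_one (weight_pos _)).2 (one_le_weight _))
  exact (add_le_add h1 h2).trans_eq one_add_one_eq_two

theorem ConvExtDerivBound.hasCylinderBound {𝓔 : L2Form Λ} {C : ℝ≥0}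
    (h : ConvExtDerivBound 𝓔 C) : HasCylinderBound 𝓔 (C * 5) := by
  intro m f g hf0 hf1 hg hg1 hg'
  refine (h _ (isCylinder_of_bounds (f := f) hg hg1 hg')).trans ?_
  rw [ENNReal.coe_mul]
  gcongr
  -- Here the `2` bounds `|fᵢ(x) - μ(fᵢ)|` for a probability measure `μ`.
  have h5 : ((5 : ℝ≥0) : ℝ≥0∞) = 2 ^ 2 + 1 := by norm_num
  rw [h5]
  refine add_le_add (iSup₂_le fun μ hμ => ?_) (supNorm_le_one fun μ => hg1 _)
  gcongr
  set κ : Measure M := (μ.toFiniteMeasure : Measure M)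
  have : IsProbabilityMeasure κ := ⟨hμ⟩
  set y : Fin (m + 1) → ℝ := fun i => ∫ x, f i x ∂κ
  rw [eLpNorm_exponent_top]
  refine (eLpNormEssSup_le_of_ae_bound (C := 2) (Eventually.of_forall fun x => ?_)).trans_eq
    (by simp)
  rw [convExtrinsicDeriv_cylinder (hg.differentiable one_ne_zero)]
  have hg'1 : ‖fderiv ℝ g y‖ ≤ 1 :=
    (hg' y).trans ((div_le_one (weight_pos _)).2 (one_le_weight _))
  refine (ContinuousLinearMap.le_of_opNorm_le_of_le _ hg'1
    ((pi_norm_le_iff_of_nonneg zero_le_two).2 fun i => ?_)).trans_eq (one_mul _)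
  have hy : ‖∫ z, f i z ∂κ‖ ≤ 1 := by
    simpa using norm_integral_le_of_norm_le_const (μ := κ) (f := f i) (C := 1)
      (Eventually.of_forall (hf1 i))
  refine (norm_sub_le _ _).trans ?_
  have := hf1 i x
  rw [← Real.norm_eq_abs] at this
  linarith

end CylinderBound

theorem AcMeasure.eval_one_nonneg {M : Type*} [MeasurableSpace M] {lam : Measure M}
    (μ : AcMeasure lam) : 0 ≤ μ.eval 1 :=
  integral_nonneg fun _ => zero_le_one

/-! ### Bounded distances to finitely many measures, and total boundedness. -/

namespace AcMeasure

variable {M : Type*} [MeasurableSpace M] {lam : Measure M} [SigmaFinite lam]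

/-- The bounded distance `ρ / (√(1 + μ(M)²) + ρ)` from `μ` to `ν`, where `ρ` is the total variation
distance. -/
noncomputable def relDist (ν μ : AcMeasure lam) : ℝ :=
  dist μ ν / (weight (μ.eval 1) + dist μ ν)

theorem relDist_denom_pos (ν μ : AcMeasure lam) : 0 < weight (μ.eval 1) + dist μ ν :=
  add_pos_of_pos_of_nonneg (weight_pos _) dist_nonneg

theorem relDist_nonneg (ν μ : AcMeasure lam) : 0 ≤ relDist ν μ :=
  div_nonneg dist_nonneg (relDist_denom_pos ν μ).le

theorem relDist_le_one (ν μ : AcMeasure lam) : relDist ν μ ≤ 1 :=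
  (div_le_one (relDist_denom_pos ν μ)).2 (by linarith [weight_pos (μ.eval 1)])

theorem relDist_le_dist (ν μ : AcMeasure lam) : relDist ν μ ≤ dist μ ν :=
  div_le_self dist_nonneg (by linarith [one_le_weight (μ.eval 1), dist_nonneg (x := μ) (y := ν)])

theorem dist_le_of_relDist_le {ν μ : AcMeasure lam} {δ : ℝ} (h : relDist ν μ ≤ δ) :
    dist μ ν ≤ δ * (weight (μ.eval 1) + dist μ ν) :=
  (div_le_iff₀ (relDist_denom_pos ν μ)).1 h

theorem abs_eval_one_sub_le (μ ν : AcMeasure lam) : |μ.eval 1 - ν.eval 1| ≤ dist μ ν :=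
  abs_eval_sub_eval_le μ ν measurable_one (by simp)

theorem continuous_eval_one : Continuous fun μ : AcMeasure lam => μ.eval 1 :=
  (LipschitzWith.of_dist_le_mul (K := 1) fun μ ν => by
    simpa [Real.dist_eq] using abs_eval_one_sub_le μ ν).continuous

theorem continuous_relDist (ν : AcMeasure lam) : Continuous (relDist ν) :=
  (continuous_id.dist continuous_const).div
    ((continuous_weight.comp continuous_eval_one).add (continuous_id.dist continuous_const))
    fun μ => (relDist_denom_pos ν μ).ne'

theorem continuous_relDist_left (μ : AcMeasure lam) : Continuous fun ν => relDist ν μ :=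
  (continuous_const.dist continuous_id).div
    (continuous_const.add (continuous_const.dist continuous_id))
    fun ν => ne_of_gt (relDist_denom_pos ν μ)

/-- The smallest of the bounded distances to `ν₀, …, νₙ`. -/
noncomputable def minRelDist (ν : ℕ → AcMeasure lam) (n : ℕ) (μ : AcMeasure lam) : ℝ :=
  (Finset.range (n + 1)).inf' Finset.nonempty_range_add_one fun k => relDist (ν k) μ

theorem minRelDist_nonneg (ν : ℕ → AcMeasure lam) (n : ℕ) (μ : AcMeasure lam) :
    0 ≤ minRelDist ν n μ :=
  Finset.le_inf' _ _ fun _ _ => relDist_nonneg _ _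

theorem minRelDist_le (ν : ℕ → AcMeasure lam) {k n : ℕ} (hk : k ≤ n) (μ : AcMeasure lam) :
    minRelDist ν n μ ≤ relDist (ν k) μ :=
  Finset.inf'_le _ (Finset.mem_range_succ_iff.2 hk)

theorem minRelDist_le_one (ν : ℕ → AcMeasure lam) (n : ℕ) (μ : AcMeasure lam) :
    minRelDist ν n μ ≤ 1 :=
  (minRelDist_le ν n.zero_le μ).trans (relDist_le_one _ _)

theorem abs_minRelDist_le_one (ν : ℕ → AcMeasure lam) (n : ℕ) (μ : AcMeasure lam) :
    |minRelDist ν n μ| ≤ 1 := by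
  rw [abs_of_nonneg (minRelDist_nonneg ν n μ)]
  exact minRelDist_le_one ν n μ

theorem exists_relDist_le_of_minRelDist_le {ν : ℕ → AcMeasure lam} {n : ℕ} {μ : AcMeasure lam}
    {δ : ℝ} (h : minRelDist ν n μ ≤ δ) : ∃ k ≤ n, relDist (ν k) μ ≤ δ := by
  obtain ⟨k, hk, hle⟩ := (Finset.inf'_le_iff _).1 h
  exact ⟨k, Finset.mem_range_succ_iff.1 hk, hle⟩

theorem antitone_minRelDist (ν : ℕ → AcMeasure lam) : Antitone (minRelDist ν) := fun _ _ h _ =>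
  Finset.inf'_mono _ (Finset.range_mono (Nat.succ_le_succ h)) _

theorem continuous_minRelDist (ν : ℕ → AcMeasure lam) (n : ℕ) : Continuous (minRelDist ν n) :=
  Continuous.finset_inf'_apply _ fun k _ => continuous_relDist (ν k)

theorem minRelDist_const_zero (ν μ : AcMeasure lam) :
    minRelDist (fun _ => ν) 0 μ = relDist ν μ := by
  simp [minRelDist]

theorem tendsto_minRelDist_of_denseRange {ν : ℕ → AcMeasure lam} (hν : DenseRange ν)
    (μ : AcMeasure lam) : Tendsto (fun n => minRelDist ν n μ) atTop (𝓝 0) := by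
  rw [Metric.tendsto_atTop]
  intro ε hε
  obtain ⟨k, hk⟩ := hν.exists_dist_lt μ hε
  refine ⟨k, fun n hn => ?_⟩
  rw [Real.dist_0_eq_abs, abs_of_nonneg (minRelDist_nonneg ν n μ)]
  exact ((minRelDist_le ν hn μ).trans (relDist_le_dist _ _)).trans_lt hk

/-- Bounds on `minRelDist` along a subsequence force total boundedness. -/
theorem totallyBounded_of_minRelDist_le {ν : ℕ → AcMeasure lam} (N : ℕ → ℕ) (l : ℕ) :
    TotallyBounded {μ : AcMeasure lam | ∀ j ≥ l, minRelDist ν (N j) μ ≤ 1 / ((j : ℝ) + 1)} := by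
  set K := {μ : AcMeasure lam | ∀ j ≥ l, minRelDist ν (N j) μ ≤ 1 / ((j : ℝ) + 1)}
  -- The weight must be bounded before `relDist` controls `dist`. At index `l + 3` the level is at
  -- most `1/4`, so `ρ ≤ weight / 3`; with `weight ≤ 1 + R + ρ` this gives `weight ≤ 3 (1 + R) / 2`.
  obtain ⟨Q, hQ⟩ : ∃ Q : ℝ, ∀ μ ∈ K, weight (μ.eval 1) ≤ Q := by
    obtain ⟨R, hR⟩ := (((Finset.range (N (l + 3) + 1)).finite_toSet.image
      fun k => (ν k).eval 1)).bddAbove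
    refine ⟨1 + (R + (1 + R) / 2), fun μ hμ => ?_⟩
    obtain ⟨k, hk, hle⟩ := exists_relDist_le_of_minRelDist_le (hμ (l + 3) (by omega))
    have hkR : (ν k).eval 1 ≤ R := hR (mem_image_of_mem _ (by simpa using Nat.lt_succ_of_le hk))
    have hδ : 1 / (((l + 3 : ℕ) : ℝ) + 1) ≤ 1 / 4 :=
      one_div_le_one_div_of_le (by norm_num) (by push_cast; linarith [l.cast_nonneg (α := ℝ)])
    have h1 := dist_le_of_relDist_le (hle.trans hδ)
    have h2 := (abs_le.1 (abs_eval_one_sub_le μ (ν k))).2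
    have h3 := weight_le (μ.eval 1)
    rw [abs_of_nonneg μ.eval_one_nonneg] at h3
    linarith
  rw [Metric.totallyBounded_iff]
  intro ε hε
  -- For a level `δ ≤ 1/2`, `ρ ≤ δ (Q + ρ)` yields `ρ ≤ 2 δ Q`.
  have hlim : Tendsto (fun j : ℕ => 2 * (1 / ((j : ℝ) + 1)) * Q) atTop (𝓝 0) := by
    simpa using ((tendsto_one_div_add_atTop_nhds_zero_nat (𝕜 := ℝ)).const_mul 2).mul_const Q
  obtain ⟨j, hjε, hjl, hj1⟩ := ((hlim.eventually_lt_const hε).and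
    ((eventually_ge_atTop l).and (eventually_ge_atTop 1))).exists
  refine ⟨ν '' (Finset.range (N j + 1)), (Finset.finite_toSet _).image _, fun μ hμ => ?_⟩
  obtain ⟨k, hk, hle⟩ := exists_relDist_le_of_minRelDist_le (hμ j hjl)
  refine mem_iUnion₂.2 ⟨ν k, mem_image_of_mem _ (by simpa using Nat.lt_succ_of_le hk), ?_⟩
  have hδ0 : 0 < 1 / ((j : ℝ) + 1) := by positivity
  have hδ : 1 / ((j : ℝ) + 1) ≤ 1 / 2 :=
    one_div_le_one_div_of_le (by norm_num) (by
      have : (1 : ℝ) ≤ j := by exact_mod_cast hj1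
      linarith)
  have h1 := dist_le_of_relDist_le hle
  have h2 := hQ μ hμ
  have h3 := dist_nonneg (x := μ) (y := ν k)
  rw [Metric.mem_ball]
  nlinarith

end AcMeasure

/-! ### Passage to the limit in the approximants, and quasi-regularity. -/

/-- The parameter of the smooth maxima, growing with the number of functions. -/
noncomputable def smoothParam (n m : ℕ) : ℝ := ((n : ℝ) + 1) * ((m : ℝ) + 2) ^ 2

theorem smoothParam_pos (n m : ℕ) : 0 < smoothParam n m := by
  unfold smoothParam
  positivity

theorem le_smoothParam (n m : ℕ) : (n : ℝ) + 1 ≤ smoothParam n m := by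
  unfold smoothParam
  have : (1 : ℝ) ≤ ((m : ℝ) + 2) ^ 2 := one_le_pow₀ (by linarith [m.cast_nonneg (α := ℝ)])
  nlinarith [n.cast_nonneg (α := ℝ)]

theorem tendsto_log_div_smoothParam (n : ℕ) :
    Tendsto (fun m : ℕ => Real.log ((m : ℝ) + 2) / smoothParam n m) atTop (𝓝 0) := by
  refine squeeze_zero (fun m => ?_) (fun m => ?_) (tendsto_one_div_add_atTop_nhds_zero_nat (𝕜 := ℝ))
  · exact div_nonneg (Real.log_nonneg (by linarith [m.cast_nonneg (α := ℝ)]))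
      (smoothParam_pos n m).le
  · have hm : (0 : ℝ) < (m : ℝ) + 1 := by positivity
    rw [div_le_div_iff₀ (smoothParam_pos n m) hm, one_mul]
    have h1 : Real.log ((m : ℝ) + 2) ≤ (m : ℝ) + 2 :=
      (Real.log_le_sub_one_of_pos (by positivity)).trans (by linarith)
    have h2 : (m + 2 : ℝ) * (m + 1) ≤ (m + 2 : ℝ) ^ 2 := by nlinarith
    have h3 : (m + 2 : ℝ) ^ 2 ≤ smoothParam n m := by
      unfold smoothParam
      nlinarith [n.cast_nonneg (α := ℝ), sq_nonneg ((m : ℝ) + 2)]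
    nlinarith

theorem tendsto_const_div_smoothParam (n : ℕ) (c : ℝ) :
    Tendsto (fun m : ℕ => c / smoothParam n m) atTop (𝓝 0) := by
  refine Tendsto.const_div_atTop ?_ c
  refine tendsto_atTop_mono (fun m => ?_) tendsto_natCast_atTop_atTop
  unfold smoothParam
  nlinarith [n.cast_nonneg (α := ℝ), m.cast_nonneg (α := ℝ), sq_nonneg ((m : ℝ) + 2)]

theorem sq_norm_le_one_of_ae_eq {E : Type*} [MeasurableSpace E] {Λ : Measure E}
    [IsProbabilityMeasure Λ] {u : Lp ℝ 2 Λ} {f : E → ℝ} (hu : u =ᵐ[Λ] f) (hf : ∀ z, |f z| ≤ 1) :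
    ‖u‖ ^ 2 ≤ 1 := by
  refine pow_le_one₀ (norm_nonneg _) ?_
  have := Lp.norm_le_of_ae_bound (f := u) (C := 1) zero_le_one
    (by filter_upwards [hu] with z hz; rw [hz]; exact hf z)
  have h1 : measureUnivNNReal Λ = 1 := by simp [measureUnivNNReal]
  simpa [h1] using this

section Limit

variable {M : Type*} [TopologicalSpace M] [MeasurableSpace M] [BorelSpace M]
  {lam : Measure M} [SigmaFinite lam] {f : ℕ → (M →ᵇ ℝ)}

/-- From below, one near-optimal `f j` suffices once `m ≥ j`; from above, every difference is at
most the distance and the smoothing error `log (m + 2) / β` vanishes. -/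
theorem tendsto_smoothGap (hf1 : ∀ j x, |f j x| ≤ 1)
    (hf : ∀ (μ ν : AcMeasure lam) (ε : ℝ), 0 < ε →
      ∃ j, dist μ ν - ε ≤ μ.eval (f j) - ν.eval (f j)) (n : ℕ) (μ ν : AcMeasure lam) :
    Tendsto (fun m : ℕ => smoothGap (smoothParam n m)
      (fun j : Fin (m + 1) => ν.eval (f j)) fun j : Fin (m + 1) => μ.eval (f j))
      atTop (𝓝 (dist μ ν)) := by
  refine tendsto_order.2 ⟨fun a ha => ?_, fun a ha => ?_⟩
  · obtain ⟨j, hj⟩ := hf μ ν ((dist μ ν - a) / 2) (by linarith)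
    filter_upwards [eventually_ge_atTop j] with m hm
    have := sub_le_smoothGap (smoothParam_pos n m) (fun j : Fin (m + 1) => ν.eval (f j))
      (fun j : Fin (m + 1) => μ.eval (f j)) ⟨j, Nat.lt_succ_of_le hm⟩
    simp only at this
    linarith
  · have hlim := (tendsto_log_div_smoothParam n).eventually_lt_const
      (show 0 < a - dist μ ν by linarith)
    filter_upwards [hlim] with m hm
    have := smoothGap_le (smoothParam_pos n m) (a := fun j : Fin (m + 1) => ν.eval (f j))
      (y := fun j : Fin (m + 1) => μ.eval (f j)) (r := dist μ ν) dist_nonneg fun j =>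
        (le_abs_self _).trans
          (AcMeasure.abs_eval_sub_eval_le μ ν (f j).continuous.measurable (hf1 j))
    linarith

theorem tendsto_smoothMinGap (hf0 : f 0 = 1) (hf1 : ∀ j x, |f j x| ≤ 1)
    (hf : ∀ (μ ν : AcMeasure lam) (ε : ℝ), 0 < ε →
      ∃ j, dist μ ν - ε ≤ μ.eval (f j) - ν.eval (f j)) (ν : ℕ → AcMeasure lam) (n : ℕ)
    (μ : AcMeasure lam) :
    Tendsto (fun m : ℕ => smoothMinGap (smoothParam n m)
      (fun (k : Fin (n + 1)) (j : Fin (m + 1)) => (ν k).eval (f j))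
      fun j : Fin (m + 1) => μ.eval (f j)) atTop (𝓝 (AcMeasure.minRelDist ν n μ)) := by
  set G : ℕ → ℕ → ℝ := fun k m => normalizedGap (smoothParam n m)
    (fun j : Fin (m + 1) => (ν k).eval (f j)) fun j : Fin (m + 1) => μ.eval (f j) with hG
  have hGlim : ∀ k, Tendsto (G k) atTop (𝓝 (AcMeasure.relDist (ν k) μ)) := fun k => by
    have hw : ∀ m : ℕ, weight (μ.eval (f ((0 : Fin (m + 1)) : ℕ))) = weight (μ.eval 1) :=
      fun m => by rw [Fin.val_zero, hf0]; rfl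
    have hT := tendsto_smoothGap hf1 hf n μ (ν k)
    refine Tendsto.div hT ?_ (AcMeasure.relDist_denom_pos (ν k) μ).ne'
    simp only [hw]
    exact hT.const_add _
  have hmin : Tendsto (fun m => (Finset.range (n + 1)).inf' Finset.nonempty_range_add_one
      fun k => G k m) atTop (𝓝 (AcMeasure.minRelDist ν n μ)) :=
    Tendsto.finset_inf'_nhds_apply _ fun k _ => hGlim k
  have hlow := hmin.sub (tendsto_const_div_smoothParam n (Real.log (n + 1)))
  rw [sub_zero] at hlow
  refine tendsto_of_tendsto_of_tendsto_of_le_of_le hlow hmin (fun m => ?_) fun m => ?_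
  · exact le_smoothMinGap (smoothParam_pos n m) fun k =>
      Finset.inf'_le (fun k => G k m) (Finset.mem_range.2 k.2)
  · exact Finset.le_inf' _ _ fun k hk =>
      smoothMinGap_le (smoothParam_pos n m) _ _ ⟨k, Finset.mem_range.1 hk⟩

variable [PolishSpace M] {Λ : Measure (AcMeasure lam)} [IsProbabilityMeasure Λ] {𝓔 : L2Form Λ}

/-- The functions `minRelDist` belong to the domain, with uniformly bounded energy. -/
theorem HasCylinderBound.exists_minRelDist_mem (h𝓔 : 𝓔.IsDirichletForm) {c : ℝ≥0}
    (hc : HasCylinderBound 𝓔 c) (ν : ℕ → AcMeasure lam) (n : ℕ) :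
    ∃ u : 𝓔.domain, ((u : Lp ℝ 2 Λ) =ᵐ[Λ] AcMeasure.minRelDist ν n) ∧
      𝓔.energyOne u ≤ c + 2 := by
  obtain ⟨f, hf0, hf1, hf⟩ := AcMeasure.exists_seq_dist_sub_le_eval lam
  set g : ℕ → AcMeasure lam → ℝ := fun m μ => smoothMinGap (smoothParam n m)
      (fun (k : Fin (n + 1)) (j : Fin (m + 1)) => (ν k).eval (f j))
      fun j : Fin (m + 1) => μ.eval (f j) with hg
  have hgb : ∀ m μ, |g m μ| ≤ 1 := fun m μ => abs_smoothMinGap_le (le_smoothParam n m) _ _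
  choose u hu hul using fun m : ℕ => L2Form.exists_of_energy_le
    (hc m (fun j => f j) (smoothMinGap (smoothParam n m)
      fun (k : Fin (n + 1)) (j : Fin (m + 1)) => (ν k).eval (f j)) (by simpa using hf0)
      (fun j => hf1 j) (contDiff_smoothMinGap (smoothParam_pos n m) _)
      (abs_smoothMinGap_le (le_smoothParam n m) _)
      (norm_fderiv_smoothMinGap_le (smoothParam_pos n m) _))
  have hmem : MemLp (AcMeasure.minRelDist ν n) 2 Λ :=
    MemLp.of_bound (AcMeasure.continuous_minRelDist ν n).aestronglyMeasurable 1
      (Eventually.of_forall fun μ => AcMeasure.abs_minRelDist_le_one ν n μ)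
  obtain ⟨x, hx, hxc⟩ := h𝓔.exists_mem_domain_of_tendsto (u := u) (c := c + 2)
    -- The energy contributes `c + 1`, and the `L²` norm of a function bounded by one contributes
    -- `1`.
    (fun m => by
      have h1 := sq_norm_le_one_of_ae_eq (hu m) (hgb m)
      have h2 := hul m
      rw [L2Form.energyOne]
      linarith)
    (tendsto_toLp_two_of_bounded (w := hmem.toLp _) hu hmem.coeFn_toLp hgb
      fun μ => tendsto_smoothMinGap hf0 hf1 hf ν n μ)
  exact ⟨x, hx ▸ hmem.coeFn_toLp, hxc⟩

/-- A uniform energy bound for cylinder functions yields a nest of compact sets. -/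
theorem HasCylinderBound.exists_compact_nest (h𝓔 : 𝓔.IsDirichletForm) {c : ℝ≥0}
    (hc : HasCylinderBound 𝓔 c) :
    ∃ K : ℕ → Set (AcMeasure lam), 𝓔.IsNest K ∧ ∀ n, IsCompact (K n) := by
  set ν : ℕ → AcMeasure lam := TopologicalSpace.denseSeq (AcMeasure lam)
  have hν : DenseRange ν := TopologicalSpace.denseRange_denseSeq _
  choose F hF hFc using hc.exists_minRelDist_mem h𝓔 ν
  have hlim : Tendsto (fun n => (F n : Lp ℝ 2 Λ)) atTop (𝓝 0) :=
    tendsto_toLp_two_of_bounded hF (Lp.coeFn_zero _ _ _) (AcMeasure.abs_minRelDist_le_one ν)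
      fun μ => AcMeasure.tendsto_minRelDist_of_denseRange hν μ
  obtain ⟨N, hN⟩ := h𝓔.exists_tendsto_capOpen hF hFc (AcMeasure.minRelDist_nonneg ν)
    (AcMeasure.antitone_minRelDist ν) hlim
  set K : ℕ → Set (AcMeasure lam) := fun l =>
    {μ | ∀ j ≥ l, AcMeasure.minRelDist ν (N j) μ ≤ 1 / ((j : ℝ) + 1)} with hK
  have hKc : ∀ l, IsClosed (K l) := fun l => by
    simp only [hK, ofPred_forall]
    exact isClosed_iInter fun j => isClosed_iInter fun _ =>
      isClosed_le (AcMeasure.continuous_minRelDist ν _) continuous_const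
  refine ⟨K, ⟨hKc, ?_⟩, fun l => isCompact_iff_totallyBounded_isComplete.2
    ⟨AcMeasure.totallyBounded_of_minRelDist_le N l, (hKc l).isComplete⟩⟩
  refine tendsto_of_tendsto_of_tendsto_of_le_of_le tendsto_const_nhds hN (fun _ => zero_le)
    fun l => ?_
  have heq : (K l)ᶜ = {z | ∃ j ≥ l, 1 / ((j : ℝ) + 1) < AcMeasure.minRelDist ν (N j) z} := by
    ext μ
    simp [hK]
  rw [← heq]
  exact 𝓔.cap_le_capOpen (hKc l).isOpen_compl Subset.rfl

/-- A uniform energy bound for cylinder functions implies quasi-regularity. -/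
theorem HasCylinderBound.isQuasiRegular (h𝓔 : 𝓔.IsDirichletForm)
    (hqc : 𝓔.HasDenseQuasiContinuous) {c : ℝ≥0} (hc : HasCylinderBound 𝓔 c) :
    𝓔.IsQuasiRegular where
  compact_nest := hc.exists_compact_nest h𝓔
  dense_quasiContinuous := hqc
  separating := by
    set ν : ℕ → AcMeasure lam := TopologicalSpace.denseSeq (AcMeasure lam)
    have hν : DenseRange ν := TopologicalSpace.denseRange_denseSeq _
    refine ⟨∅, fun k => AcMeasure.relDist (ν k), 𝓔.cap_empty, fun k =>
      ⟨𝓔.quasiContinuous_of_continuous (AcMeasure.continuous_relDist _), ?_⟩,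
      fun μ₁ _ μ₂ _ hne => ?_⟩
    · obtain ⟨u, hu, -⟩ := hc.exists_minRelDist_mem h𝓔 (fun _ => ν k) 0
      refine ⟨u, hu.trans (Eventually.of_forall fun μ => ?_)⟩
      exact AcMeasure.minRelDist_const_zero _ _
    -- Equality of the bounded distances to all `νₖ` extends by continuity to every base point; the
    -- base point `μ₁` then forces `dist μ₂ μ₁ = 0`.
    · by_contra! hall
      have heq : (fun κ => AcMeasure.relDist κ μ₁) = fun κ => AcMeasure.relDist κ μ₂ :=
        hν.equalizer (AcMeasure.continuous_relDist_left μ₁) (AcMeasure.continuous_relDist_left μ₂)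
          (funext hall)
      have h0 := congrFun heq μ₁
      simp only [AcMeasure.relDist, dist_self, zero_div] at h0
      rcases div_eq_zero_iff.1 h0.symm with h1 | h1
      · exact hne (dist_eq_zero.1 h1).symm
      · exact (AcMeasure.relDist_denom_pos μ₁ μ₂).ne' h1

end Limit

/-! ### Transport to a subset of full measure. -/

namespace L2Form

section Restrict

variable {E : Type*} [MeasurableSpace E] {Λ : Measure E} (𝓔 : L2Form Λ) {s : Set E}
  (hs : MeasurableSet s) (h : ∀ᵐ z ∂Λ, z ∈ s)

/-- The identification of the domain of a form with that of its restriction. -/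
noncomputable def restrictEquiv : 𝓔.domain ≃ₗ[ℝ] (𝓔.restrict hs h).domain :=
  Submodule.equivMapOfInjective
    (Lp.compMeasurePreservingₗᵢ ℝ Subtype.val
      (measurePreserving_subtypeVal_of_ae_mem hs h)).toLinearMap
    (LinearIsometry.injective _) 𝓔.domain

theorem coe_restrictEquiv (u : 𝓔.domain) :
    (𝓔.restrictEquiv hs h u : Lp ℝ 2 (Λ.comap (Subtype.val : s → E))) =
      Lp.compMeasurePreservingₗᵢ ℝ Subtype.val (measurePreserving_subtypeVal_of_ae_mem hs h)
        (u : Lp ℝ 2 Λ) := rfl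

theorem coeFn_restrictEquiv (u : 𝓔.domain) :
    (𝓔.restrictEquiv hs h u : Lp ℝ 2 (Λ.comap (Subtype.val : s → E)))
      =ᵐ[Λ.comap (Subtype.val : s → E)] (u : Lp ℝ 2 Λ) ∘ Subtype.val :=
  Lp.coeFn_compMeasurePreserving _ _

theorem form_restrictEquiv (u v : 𝓔.domain) :
    (𝓔.restrict hs h).form (𝓔.restrictEquiv hs h u) (𝓔.restrictEquiv hs h v) = 𝓔.form u v := by
  have : ∀ u v, (𝓔.restrict hs h).form u v =
      𝓔.form ((𝓔.restrictEquiv hs h).symm u) ((𝓔.restrictEquiv hs h).symm v) := fun _ _ => rfl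
  rw [this, LinearEquiv.symm_apply_apply, LinearEquiv.symm_apply_apply]

theorem energyOne_restrictEquiv (u : 𝓔.domain) :
    (𝓔.restrict hs h).energyOne (𝓔.restrictEquiv hs h u) = 𝓔.energyOne u := by
  rw [energyOne, energyOne, form_restrictEquiv, coe_restrictEquiv, LinearIsometry.norm_map]

variable {𝓔}

theorem ae_comap_subtypeVal (hs : MeasurableSet s) (h : ∀ᵐ z ∂Λ, z ∈ s) {p : E → Prop}
    (hp : ∀ᵐ z ∂Λ, p z) : ∀ᵐ z : s ∂(Λ.comap (Subtype.val : s → E)), p z :=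
  (measurePreserving_subtypeVal_of_ae_mem hs h).quasiMeasurePreserving.ae hp

/-- Extension by zero outside `s` is a preimage. Surjectivity carries the density of the domain over
to the restricted form. -/
theorem surjective_compMeasurePreserving_subtypeVal :
    Function.Surjective (Lp.compMeasurePreservingₗᵢ (E := ℝ) (p := 2) ℝ (Subtype.val : s → E)
      (measurePreserving_subtypeVal_of_ae_mem hs h)) := by
  intro v
  have hmp := measurePreserving_subtypeVal_of_ae_mem hs h
  set F : E → ℝ := Function.extend Subtype.val v 0
  have hFv : F ∘ Subtype.val = v := Function.extend_comp Subtype.val_injective _ _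
  have hF : MemLp F 2 Λ := by
    rw [← hmp.map_eq, (MeasurableEmbedding.subtype_coe hs).memLp_map_measure_iff, hFv]
    exact Lp.memLp v
  refine ⟨hF.toLp F, (Lp.toLp_compMeasurePreserving hF hmp).trans (Lp.ext ?_)⟩
  exact (MemLp.coeFn_toLp _).trans (Eventually.of_forall (congrFun hFv))

theorem IsDirichletForm.restrict (h𝓔 : 𝓔.IsDirichletForm) :
    (𝓔.restrict hs h).IsDirichletForm where
  dense :=
    (surjective_compMeasurePreserving_subtypeVal hs h).denseRange.dense_image
      (LinearIsometry.continuous _) h𝓔.dense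
  symm u v := by
    obtain ⟨u, rfl⟩ := (𝓔.restrictEquiv hs h).surjective u
    obtain ⟨v, rfl⟩ := (𝓔.restrictEquiv hs h).surjective v
    rw [form_restrictEquiv, form_restrictEquiv, h𝓔.symm]
  nonneg u := by
    obtain ⟨u, rfl⟩ := (𝓔.restrictEquiv hs h).surjective u
    rw [form_restrictEquiv]
    exact h𝓔.nonneg u
  complete u hu := by
    obtain ⟨u, rfl⟩ : ∃ u' : ℕ → 𝓔.domain, u = fun n => 𝓔.restrictEquiv hs h (u' n) :=
      ⟨fun n => (𝓔.restrictEquiv hs h).symm (u n), by simp⟩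
    simp only [← map_sub, energyOne_restrictEquiv] at hu
    obtain ⟨v, hv⟩ := h𝓔.complete u hu
    refine ⟨𝓔.restrictEquiv hs h v, ?_⟩
    simpa only [← map_sub, energyOne_restrictEquiv] using hv
  markov u := by
    obtain ⟨u, rfl⟩ := (𝓔.restrictEquiv hs h).surjective u
    obtain ⟨w, hw, hle⟩ := h𝓔.markov u
    refine ⟨𝓔.restrictEquiv hs h w, ?_, ?_⟩
    · filter_upwards [𝓔.coeFn_restrictEquiv hs h u, 𝓔.coeFn_restrictEquiv hs h w,
        ae_comap_subtypeVal hs h hw] with z h1 h2 h3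
      rw [h1, h2, Function.comp_apply, Function.comp_apply, h3]
    · rwa [← map_add, ← map_sub, form_restrictEquiv]

/-- Any competitor for `O` restricts to a competitor of the same energy, so restriction preserves
nests and sets of capacity zero. -/
theorem capOpen_restrict_le (𝓔 : L2Form Λ) (O : Set E) :
    (𝓔.restrict hs h).capOpen (Subtype.val ⁻¹' O) ≤ 𝓔.capOpen O := by
  refine le_iInf₂ fun u hu => ?_
  rw [← 𝓔.energyOne_restrictEquiv hs h]
  refine iInf₂_le _ ?_
  filter_upwards [𝓔.coeFn_restrictEquiv hs h u, ae_comap_subtypeVal hs h hu]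
    with z h1 h2 hz
  rw [h1]
  exact h2 hz

theorem ae_eq_restrictEquiv {u : 𝓔.domain} {f : E → ℝ} (hu : (u : Lp ℝ 2 Λ) =ᵐ[Λ] f) :
    (𝓔.restrictEquiv hs h u : Lp ℝ 2 (Λ.comap (Subtype.val : s → E)))
      =ᵐ[Λ.comap (Subtype.val : s → E)] f ∘ Subtype.val :=
  (𝓔.coeFn_restrictEquiv hs h u).trans (ae_comap_subtypeVal hs h hu)

variable [TopologicalSpace E]

theorem cap_restrict_le (𝓔 : L2Form Λ) (A : Set E) :
    (𝓔.restrict hs h).cap (Subtype.val ⁻¹' A) ≤ 𝓔.cap A :=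
  le_iInf fun O => le_iInf₂ fun hO hA =>
    (cap_le_capOpen _ (hO.preimage continuous_subtype_val) (preimage_mono hA)).trans
      (capOpen_restrict_le hs h 𝓔 O)

theorem IsNest.restrict {K : ℕ → Set E} (hK : 𝓔.IsNest K) :
    (𝓔.restrict hs h).IsNest fun n => Subtype.val ⁻¹' K n :=
  ⟨fun n => (hK.1 n).preimage continuous_subtype_val,
    tendsto_of_tendsto_of_tendsto_of_le_of_le tendsto_const_nhds hK.2 (fun _ => zero_le)
      fun n => cap_restrict_le hs h 𝓔 (K n)ᶜ⟩

theorem QuasiContinuous.restrict {f : E → ℝ} (hf : 𝓔.QuasiContinuous f) :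
    (𝓔.restrict hs h).QuasiContinuous (f ∘ Subtype.val) := by
  obtain ⟨hm, K, hK, hc⟩ := hf
  exact ⟨hm.comp measurable_subtype_coe, _, hK.restrict hs h, fun n =>
    (hc n).comp continuous_subtype_val.continuousOn fun _ hz => hz⟩

/-- Quasi-regularity is inherited by closed sets of full measure. -/
theorem IsQuasiRegular.restrict (hsc : IsClosed s) (h𝓔 : 𝓔.IsQuasiRegular) :
    (𝓔.restrict hs h).IsQuasiRegular where
  compact_nest := by
    obtain ⟨K, hK, hKc⟩ := h𝓔.compact_nest
    -- Closedness of `s` keeps the traces of compact sets compact.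
    exact ⟨_, hK.restrict hs h, fun n => hsc.isClosedEmbedding_subtypeVal.isCompact_preimage (hKc n)⟩
  dense_quasiContinuous := by
    obtain ⟨S, hS, hd⟩ := h𝓔.dense_quasiContinuous
    refine ⟨S.map (𝓔.restrictEquiv hs h).toLinearMap, ?_, fun u ε hε => ?_⟩
    · rintro _ ⟨u, hu, rfl⟩
      obtain ⟨f, hf, huf⟩ := hS u hu
      exact ⟨f ∘ Subtype.val, hf.restrict hs h, ae_eq_restrictEquiv hs h huf⟩
    · obtain ⟨u, rfl⟩ := (𝓔.restrictEquiv hs h).surjective u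
      obtain ⟨v, hv, hlt⟩ := hd u ε hε
      refine ⟨𝓔.restrictEquiv hs h v, Submodule.mem_map_of_mem hv, ?_⟩
      rwa [← map_sub, energyOne_restrictEquiv]
  separating := by
    obtain ⟨N, f, hN, hf, hsep⟩ := h𝓔.separating
    refine ⟨Subtype.val ⁻¹' N, fun n => f n ∘ Subtype.val,
      le_antisymm ((cap_restrict_le hs h 𝓔 N).trans_eq hN) zero_le, fun n => ?_,
      fun z₁ h₁ z₂ h₂ hne => hsep z₁ h₁ z₂ h₂ (Subtype.coe_injective.ne hne)⟩
    obtain ⟨hq, u, hu⟩ := hf n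
    exact ⟨hq.restrict hs h, 𝓔.restrictEquiv hs h u, ae_eq_restrictEquiv hs h hu⟩

end Restrict

end L2Form

theorem theorem2p3 {M : Type*} [TopologicalSpace M] [PolishSpace M] [MeasurableSpace M]
    [BorelSpace M] (lam : Measure M) [SigmaFinite lam]
    (Λ : Measure (AcMeasure lam)) [IsProbabilityMeasure Λ]
    (𝓔 : L2Form Λ) (h𝓔 : 𝓔.IsDirichletForm) (hqc : 𝓔.HasDenseQuasiContinuous) :
    ((∃ C : ℝ≥0, 0 < C ∧ ExtDerivBound 𝓔 C) → 𝓔.IsQuasiRegular) ∧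
    ∀ hP : Λ (probAc lam) = 1, (∃ C : ℝ≥0, 0 < C ∧ ConvExtDerivBound 𝓔 C) →
      𝓔.IsQuasiRegular ∧ (𝓔.toProbAc hP).IsDirichletForm ∧ (𝓔.toProbAc hP).IsQuasiRegular := by
  refine ⟨fun ⟨C, _, hC⟩ => hC.hasCylinderBound.isQuasiRegular h𝓔 hqc, fun hP ⟨C, _, hC⟩ => ?_⟩
  have hQ := hC.hasCylinderBound.isQuasiRegular h𝓔 hqc
  exact ⟨hQ, h𝓔.restrict _ _, hQ.restrict _ _ (isClosed_probAc lam)⟩
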